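/- Let $\mu$ be normalized Haar measure on $SU(2)$, and let $d(x,y)=\sqrt{\tfrac12\operatorname{tr}\big((x-y)(x-y)^*\big)}$ for $x,y\in SU(2)$. Let $e$ be the identity matrix. For integrable $f,g$ on $SU(2)$ put $(f*g)(x)=\int_{SU(2)}f(xy^{-1})g(y)\,d\mu(y)$. Call $f\in L^1(SU(2))$ *central* if $f*g=g*f$ in $L^1(SU(2))$ for every $g\in L^1(SU(2))$. For $n\ge 0$ let $\chi_n$ be the character (trace) of the $(n+1)$-dimensional irreducible representation $\pi_n$ of $SU(2)$, realized on the complex homogeneous polynomials of degree $n$ in two variables by $(\pi_n(x)p)(z)=p(zx)$. Let $\mathbf D_N=\sum_{n=0}^N(n+1)\chi_n$, and let $S_Nf=f*\mathbf D_N$ be the $N$th Fourier partial sum of $f$. **Theorem.** Let $0<\alpha<1$ and let $f:SU(2)\to\mathbb R$ be a central function that is $\alpha$-Hölder continuous, that is, there is $M\ge 0$ with $|f(x)-f(y)|\le M\,d(x,y)^\alpha$ for all $x,y\in SU(2)$. Then: (a) for every open set $U\subseteq SU(2)$ containing both $e$ and $-e$, $S_Nf\to f$ uniformly on $SU(2)\setminus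 U$ as $N\to\infty$; (b) if both sequences $\{S_Nf(e)\}_{N=0}^\infty$ and $\{S_Nf(-e)\}_{N=0}^\infty$ converge, then $S_Nf\to f$ uniformly on $SU(2)$. -/

import Mathlib

open MeasureTheory Filter Topology

/-- The special unitary group `SU(2)`, with the group structure of Mathlib and the topology
inherited from the `2 × 2` complex matrices. -/
abbrev SU2 : Type := Matrix.specialUnitaryGroup (Fin 2) ℂ

namespace SU2

instance instContinuousInv : ContinuousInv SU2 where
  continuous_inv := by
    refine Continuous.subtype_mk (f := fun x : SU2 => star (x : Matrix (Fin 2) (Fin 2) ℂ)) ?_ _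
    exact continuous_star.comp continuous_subtype_val

instance instIsTopologicalGroup : IsTopologicalGroup SU2 where

instance instCompactSpace : CompactSpace SU2 := by
  refine isCompact_iff_compactSpace.mp ?_
  have hK : IsCompact (Set.pi Set.univ fun _ : Fin 2 => Set.pi Set.univ fun _ : Fin 2 =>
      Metric.closedBall (0 : ℂ) 1) :=
    isCompact_univ_pi fun _ => isCompact_univ_pi fun _ => isCompact_closedBall _ _
  have hclosed : IsClosed {A : Matrix (Fin 2) (Fin 2) ℂ | A * star A = 1 ∧ A.det = 1} := by
    refine IsClosed.inter ?_ ?_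
    · exact isClosed_eq (continuous_id.mul continuous_star) continuous_const
    · exact isClosed_eq (Continuous.matrix_det continuous_id) continuous_const
  have heq : (Matrix.specialUnitaryGroup (Fin 2) ℂ : Set (Matrix (Fin 2) (Fin 2) ℂ)) =
      {A : Matrix (Fin 2) (Fin 2) ℂ | A * star A = 1 ∧ A.det = 1} := by
    ext A
    simp [Matrix.mem_specialUnitaryGroup_iff, Matrix.mem_unitaryGroup_iff]
  rw [heq]
  refine IsCompact.of_isClosed_subset hK hclosed ?_
  rintro A ⟨hA, -⟩ i - j -
  simpa using entry_norm_bound_of_unitary (Matrix.mem_unitaryGroup_iff.mpr hA) i j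

/-- `SU(2)` carries its Borel σ-algebra. -/
noncomputable instance instMeasurableSpace : MeasurableSpace SU2 := borel SU2

instance instBorelSpace : BorelSpace SU2 := ⟨rfl⟩

/-- Normalized Haar measure on `SU(2)`: the Haar measure that gives the whole group mass `1`. -/
noncomputable def haar : Measure SU2 := Measure.haarMeasure ⊤

/-- The element `-e` of `SU(2)`. -/
noncomputable def negOne : SU2 :=
  ⟨-1, by simp [Matrix.mem_specialUnitaryGroup_iff, Matrix.mem_unitaryGroup_iff, Matrix.det_neg]⟩

/-- The bi-invariant distance `d(x, y) = √(½ tr ((x - y)(x - y)*))` on `SU(2)`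
(the trace is a non-negative real number). -/
noncomputable def distance (x y : SU2) : ℝ :=
  Real.sqrt (1 / 2 * (Matrix.trace
    ((x.val - y.val) * star (x.val - y.val))).re)

/-- `f ∈ Lip_α(SU(2))`: the real function `f` is `α`-Hölder continuous. -/
def IsHolder (α : ℝ) (f : SU2 → ℝ) : Prop :=
  ∃ M : ℝ, 0 ≤ M ∧ ∀ x y : SU2, |f x - f y| ≤ M * distance x y ^ α

/-- The convolution `(f ∗ g)(x) = ∫ f(x y⁻¹) g(y) dμ(y)`. -/
noncomputable def conv (f g : SU2 → ℂ) (x : SU2) : ℂ :=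
  ∫ y, f (x * y⁻¹) * g y ∂haar

/-- `f` is central: `f ∈ L¹(SU(2))` and `f ∗ g = g ∗ f` in `L¹(SU(2))` for all
`g ∈ L¹(SU(2))`. -/
def IsCentral (f : SU2 → ℂ) : Prop :=
  Integrable f haar ∧ ∀ g : SU2 → ℂ, Integrable g haar → conv f g =ᵐ[haar] conv g f

/-- The substitution `p(z) ↦ p(z x)` on polynomials in two variables, where `z = (z₀, z₁)` is
a row vector. -/
noncomputable def subst (x : SU2) : MvPolynomial (Fin 2) ℂ →ₐ[ℂ] MvPolynomial (Fin 2) ℂ :=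
  MvPolynomial.aeval fun j : Fin 2 =>
    ∑ i : Fin 2, MvPolynomial.C ((x : Matrix (Fin 2) (Fin 2) ℂ) i j) * MvPolynomial.X i

theorem subst_mem (n : ℕ) (x : SU2) (p : MvPolynomial (Fin 2) ℂ)
    (hp : p ∈ MvPolynomial.homogeneousSubmodule (Fin 2) ℂ n) :
    subst x p ∈ MvPolynomial.homogeneousSubmodule (Fin 2) ℂ n := by
  rw [MvPolynomial.mem_homogeneousSubmodule] at hp ⊢
  have h := hp.aeval (fun j : Fin 2 => ∑ i : Fin 2,
      MvPolynomial.C ((x : Matrix (Fin 2) (Fin 2) ℂ) i j) * MvPolynomial.X i) (n := 1)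
    (fun j => MvPolynomial.IsHomogeneous.sum _ _ _ fun i _ => by
      simpa using (MvPolynomial.isHomogeneous_C (Fin 2)
        ((x : Matrix (Fin 2) (Fin 2) ℂ) i j)).mul (MvPolynomial.isHomogeneous_X ℂ i))
  simpa [subst] using h

theorem subst_one : subst 1 = AlgHom.id ℂ _ := by
  refine MvPolynomial.algHom_ext fun j => ?_
  fin_cases j <;> simp [subst]

theorem subst_mul (x y : SU2) : subst (x * y) = (subst x).comp (subst y) := by
  refine MvPolynomial.algHom_ext fun j => ?_
  simp [subst, Matrix.mul_apply, Fin.sum_univ_two]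
  ring

/-- The irreducible representation `π_n` of `SU(2)`, of dimension `n + 1`: the action by linear
substitution `(π_n(x) p)(z) = p(z x)` on the complex homogeneous polynomials of degree `n` in two
variables. Up to equivalence, `π₀, π₁, π₂, …` are all the continuous irreducible unitary
representations of `SU(2)`. -/
noncomputable def irrep (n : ℕ) :
    Representation ℂ SU2 (MvPolynomial.homogeneousSubmodule (Fin 2) ℂ n) where
  toFun x := (subst x).toLinearMap.restrict (subst_mem n x)
  map_one' := by
    ext1 p
    apply Subtype.ext
    simp [subst_one]
  map_mul' x y := by
    ext1 p
    apply Subtype.ext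
    exact congrArg (fun φ => φ (p : MvPolynomial (Fin 2) ℂ)) (subst_mul x y)

/-- The character `χ_n(x) = trace π_n(x)`. -/
noncomputable def character (n : ℕ) (x : SU2) : ℂ :=
  LinearMap.trace ℂ _ (irrep n x)

/-- The Dirichlet kernel `D_N = ∑_{n=0}^N (n + 1) χ_n`. -/
noncomputable def dirichletKernel (N : ℕ) (x : SU2) : ℂ :=
  ∑ n ∈ Finset.range (N + 1), ((n : ℂ) + 1) * character n x

/-- The `N`-th Fourier partial sum `S_N f = f ∗ D_N`. -/
noncomputable def fourierSum (N : ℕ) (f : SU2 → ℂ) : SU2 → ℂ :=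
  conv f (dirichletKernel N)

end SU2

/-!
Write `a_n` for the cosine coefficients of `θ ↦ f (diag(e^{iθ}, e^{-iθ}))`. By Schur's lemma
`(n + 1) f ∗ χ_n = ⟨f, χ_n⟩ χ_n` for a class function `f`, and by Weyl's integration formula
`⟨f, χ_n⟩ = (a_n - a_{n+2}) / 2`. Since `χ_n = U_n(cos θ)` with `2 T_n = U_n - U_{n-2}`, summation
by parts gives
`S_N f = a_0 / 2 + ∑_{n ≤ N} a_n cos(n θ) - (U_{N-1}(cos θ) a_{N+1} + U_N(cos θ) a_{N+2}) / 2`.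
The cosine series converges uniformly to `f`, as `f` is Hölder continuous, so only the two edge
terms matter. Away from `±e` the `U_N(cos θ)` are uniformly bounded and `a_n → 0`, which gives (a).

As `|U_{N-1}| ≤ N`, (b) amounts to `N a_{N+1} → 0`. Convergence at `e` and at `-e` says that
`N a_{N+1} ± (N + 1) a_{N+2}` both converge, and their limits vanish: by Kronecker's lemma, the
convergence of `∑ a_n` and of `∑ (-1)^n a_n` forces the Cesàro means of these sequences to `0`.
-/

theorem tendstoUniformlyOn_zero_of_norm_le {X E : Type*} [SeminormedAddCommGroup E]
    {u : ℕ → X → E} {b : ℕ → ℝ} {A : Set X} (hu : ∀ N, ∀ x ∈ A, ‖u N x‖ ≤ b N)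
    (hb : Tendsto b atTop (𝓝 0)) : TendstoUniformlyOn u 0 atTop A := by
  rw [Metric.tendstoUniformlyOn_iff]
  refine fun ε hε => (hb.eventually_lt_const hε).mono fun N hN x hx => ?_
  rw [Pi.zero_apply, dist_zero_left]
  exact (hu N x hx).trans_lt hN

section CosineSeries

open Real intervalIntegral
open scoped NNReal

/-- The Dirichlet kernel `1/2 + ∑_{n=1}^N cos(n t)` of the circle. -/
noncomputable def trigDirichletKernel (N : ℕ) (t : ℝ) : ℝ :=
  1 / 2 + ∑ n ∈ Finset.range N, cos ((n + 1 : ℕ) * t)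

@[fun_prop]
theorem continuous_trigDirichletKernel (N : ℕ) : Continuous (trigDirichletKernel N) := by
  unfold trigDirichletKernel
  fun_prop

theorem trigDirichletKernel_mul_two_mul_sin_half (N : ℕ) (t : ℝ) :
    trigDirichletKernel N t * (2 * sin (t / 2)) = sin ((N + 1 / 2) * t) := by
  induction N with
  | zero =>
    simp only [trigDirichletKernel, Finset.range_zero, Finset.sum_empty, Nat.cast_zero]
    ring_nf
  | succ N ih =>
    have hstep : trigDirichletKernel (N + 1) t =
        trigDirichletKernel N t + cos ((N + 1 : ℕ) * t) := by
      simp only [trigDirichletKernel, Finset.sum_range_succ, add_assoc]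
    rw [hstep, add_mul, ih]
    push_cast
    rw [show ((N : ℝ) + 1 / 2) * t = (N + 1) * t - t / 2 by ring,
      show ((N : ℝ) + 1 + 1 / 2) * t = (N + 1) * t + t / 2 by ring, sin_add, sin_sub]
    ring

theorem integral_cos_natCast_mul {n : ℕ} (hn : n ≠ 0) : ∫ t in -π..π, cos (n * t) = 0 := by
  rw [integral_comp_mul_left (fun t => cos t) (Nat.cast_ne_zero.mpr hn), integral_cos, mul_neg,
    sin_neg, sin_nat_mul_pi, neg_zero, sub_zero, smul_zero]

theorem integral_trigDirichletKernel (N : ℕ) : ∫ t in -π..π, trigDirichletKernel N t = π := by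
  simp only [trigDirichletKernel]
  rw [integral_add (by simp) (Continuous.intervalIntegrable (by fun_prop) _ _),
    integral_finsetSum fun n _ => Continuous.intervalIntegrable (by fun_prop) _ _]
  simp only [integral_cos_natCast_mul (Nat.succ_ne_zero _), Finset.sum_const_zero,
    intervalIntegral.integral_const, smul_eq_mul]
  ring

theorem abs_le_pi_mul_abs_sin_half {t : ℝ} (ht : |t| ≤ π) : |t| ≤ π * |sin (t / 2)| := by
  have h := mul_abs_le_abs_sin (x := t / 2) (by rw [abs_div, abs_two]; linarith)
  rw [abs_div, abs_two] at h
  calc |t| = π * (2 / π * (|t| / 2)) := by field_simp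
    _ ≤ π * |sin (t / 2)| := by gcongr

theorem intervalIntegrable_abs_rpow {r : ℝ} (hr : -1 < r) {b : ℝ} (hb : 0 ≤ b) :
    IntervalIntegrable (fun t => |t| ^ r) volume (-b) b := by
  have hpos : IntervalIntegrable (fun t => |t| ^ r) volume 0 b := by
    refine (intervalIntegrable_rpow' hr).congr fun t ht => ?_
    rw [Set.uIoc_of_le hb] at ht
    simp only [abs_of_pos ht.1]
  have hneg : IntervalIntegrable (fun t => |t| ^ r) volume (-b) 0 := by
    simpa using ((IntervalIntegrable.iff_comp_neg (f := fun t => |t| ^ r)).mp hpos).symm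
  exact hneg.trans hpos

variable {E : Type*} [NormedAddCommGroup E]

/-- Half of the Hölder exponent goes to the increment `h`, where it makes the Dirichlet kernel
integrable, and half to `s - t`, where it yields equicontinuity. -/
theorem norm_sub_sub_sub_le_of_holderWith {V : Type*} [SeminormedAddCommGroup V] {F : V → E}
    {C r : ℝ≥0} (hF : HolderWith C r F) (s t h : V) :
    ‖(F (s + h) - F s) - (F (t + h) - F t)‖ ≤
      2 * C * ‖s - t‖ ^ (r / 2 : ℝ) * ‖h‖ ^ (r / 2 : ℝ) := by
  have hdist (a b : V) : ‖F a - F b‖ ≤ C * ‖a - b‖ ^ (r : ℝ) := by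
    simpa only [dist_eq_norm] using hF.dist_le a b
  have hsq (a : V) : ‖a‖ ^ (r : ℝ) = (‖a‖ ^ (r / 2 : ℝ)) ^ 2 := by
    rw [← rpow_mul_natCast (norm_nonneg a)]
    norm_num
  have hle_h : ‖(F (s + h) - F s) - (F (t + h) - F t)‖ ≤ 2 * C * ‖h‖ ^ (r : ℝ) := by
    have hs := hdist (s + h) s
    have ht := hdist (t + h) t
    rw [add_sub_cancel_left] at hs ht
    linarith [norm_sub_le (F (s + h) - F s) (F (t + h) - F t)]
  have hle_st : ‖(F (s + h) - F s) - (F (t + h) - F t)‖ ≤ 2 * C * ‖s - t‖ ^ (r : ℝ) := by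
    have hh := hdist (s + h) (t + h)
    rw [add_sub_add_right_eq_sub] at hh
    rw [sub_sub_sub_comm]
    linarith [norm_sub_le (F (s + h) - F (t + h)) (F s - F t), hdist s t]
  refine (pow_le_pow_iff_left₀ (norm_nonneg _) (by positivity) two_ne_zero).mp ?_
  calc ‖(F (s + h) - F s) - (F (t + h) - F t)‖ ^ 2
      ≤ (2 * C * ‖s - t‖ ^ (r : ℝ)) * (2 * C * ‖h‖ ^ (r : ℝ)) := by
        rw [sq]
        gcongr
    _ = (2 * C * ‖s - t‖ ^ (r / 2 : ℝ) * ‖h‖ ^ (r / 2 : ℝ)) ^ 2 := by rw [hsq, hsq]; ring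

section Real

variable [NormedSpace ℝ E]

theorem norm_inv_two_mul_sin_half_smul_le {t C r : ℝ} {y : E} (ht : |t| ≤ π) (hC : 0 ≤ C)
    (hy : ‖y‖ ≤ C * |t| ^ r) :
    ‖(2 * sin (t / 2))⁻¹ • y‖ ≤ C * (π / 2) * |t| ^ (r - 1) := by
  rcases eq_or_ne t 0 with rfl | h0
  · simpa using by positivity
  have htpos : 0 < |t| := abs_pos.mpr h0
  have hs : |t| ≤ π * |sin (t / 2)| := abs_le_pi_mul_abs_sin_half ht
  have hspos : 0 < |sin (t / 2)| := pos_of_mul_pos_right (htpos.trans_le hs) pi_pos.le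
  rw [norm_smul, norm_inv, Real.norm_eq_abs, abs_mul, abs_two, rpow_sub_one htpos.ne',
    inv_mul_le_iff₀ (by positivity)]
  calc ‖y‖ ≤ C * |t| ^ r := hy
    _ = C * |t| ^ r / |t| * |t| := by field_simp
    _ ≤ C * |t| ^ r / |t| * (π * |sin (t / 2)|) := by gcongr
    _ = 2 * |sin (t / 2)| * (C * (π / 2) * (|t| ^ r / |t|)) := by ring

/-- The `n`-th cosine coefficient `a_n = π⁻¹ ∫_{-π}^π F(t) cos(n t) dt`, normalized so that the
cosine series of `F` is `a₀/2 + ∑_{n ≥ 1} a_n cos(n θ)`. -/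
noncomputable def cosCoeff (F : ℝ → E) (n : ℕ) : E :=
  π⁻¹ • ∫ t in -π..π, cos (n * t) • F t

/-- The `N`-th partial sum `a₀/2 + ∑_{n=1}^N a_n cos(n θ)` of the cosine series of `F`. -/
noncomputable def cosPartialSum (F : ℝ → E) (N : ℕ) (θ : ℝ) : E :=
  (1 / 2 : ℝ) • cosCoeff F 0 + ∑ n ∈ Finset.range N, cos ((n + 1 : ℕ) * θ) • cosCoeff F (n + 1)

theorem cosCoeff_one (n : ℕ) : cosCoeff (fun _ => (1 : ℝ)) n = if n = 0 then 2 else 0 := by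
  simp only [cosCoeff, smul_eq_mul, mul_one]
  split_ifs with hn
  · simp only [hn, Nat.cast_zero, zero_mul, cos_zero, intervalIntegral.integral_const, smul_eq_mul]
    field_simp
    norm_num
  · rw [integral_cos_natCast_mul hn, mul_zero]

theorem integral_sin_smul_of_even {F : ℝ → E} (heven : Function.Even F) (n : ℕ) :
    ∫ t in -π..π, sin (n * t) • F t = 0 := by
  have h := integral_comp_neg (a := -π) (b := π) (fun t => sin (n * t) • F t)
  simp only [heven _, mul_neg, sin_neg, neg_smul, neg_neg, intervalIntegral.integral_neg] at h
  have : IsAddTorsionFree E := .of_isTorsionFree ℝ E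
  exact self_eq_neg.mp h.symm

theorem integral_cos_smul_comp_add {F : ℝ → E} (hF : Continuous F)
    (hper : Function.Periodic F (2 * π)) (heven : Function.Even F) (n : ℕ) (θ : ℝ) :
    ∫ t in -π..π, cos (n * t) • F (θ + t) = cos (n * θ) • π • cosCoeff F n := by
  have hper' : Function.Periodic (fun u => cos (n * (u - θ)) • F u) (2 * π) := fun u => by
    simp only [hper u]
    rw [show (n : ℝ) * (u + 2 * π - θ) = n * (u - θ) + n * (2 * π) by ring,
      cos_add_nat_mul_two_pi]
  have hshift := integral_comp_add_left (a := -π) (b := π)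
    (fun u => cos (n * (u - θ)) • F u) θ
  simp only [add_sub_cancel_left] at hshift
  have hperiod := hper'.intervalIntegral_add_eq (θ + -π) (-π)
  rw [show θ + -π + 2 * π = θ + π by ring, show -π + 2 * π = π by ring] at hperiod
  calc ∫ t in -π..π, cos (n * t) • F (θ + t)
      = ∫ u in -π..π, cos (n * (u - θ)) • F u := hshift.trans hperiod
    _ = ∫ u in -π..π, (cos (n * θ) • cos (n * u) • F u + sin (n * θ) • sin (n * u) • F u) := by
        refine integral_congr fun u _ => ?_
        simp only [mul_sub, cos_sub, add_smul, mul_smul, smul_comm (cos (n * u)),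
          smul_comm (sin (n * u))]
    _ = cos (n * θ) • ∫ u in -π..π, cos (n * u) • F u := by
        rw [integral_add (Continuous.intervalIntegrable (by fun_prop) _ _)
          (Continuous.intervalIntegrable (by fun_prop) _ _), intervalIntegral.integral_smul,
          intervalIntegral.integral_smul, integral_sin_smul_of_even heven, smul_zero, add_zero]
    _ = cos (n * θ) • π • cosCoeff F n := by
        rw [cosCoeff, smul_inv_smul₀ pi_ne_zero]

theorem periodic_cosPartialSum (F : ℝ → E) (N : ℕ) :
    Function.Periodic (cosPartialSum F N) (2 * π) := fun θ => by
  simp only [cosPartialSum, mul_add, cos_add_nat_mul_two_pi]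

theorem cosPartialSum_sub_self [CompleteSpace E] {F : ℝ → E} (hF : Continuous F)
    (hper : Function.Periodic F (2 * π)) (heven : Function.Even F) (N : ℕ) (θ : ℝ) :
    cosPartialSum F N θ - F θ =
      π⁻¹ • ∫ t in -π..π, trigDirichletKernel N t • (F (θ + t) - F θ) := by
  have hconv : ∫ t in -π..π, trigDirichletKernel N t • F (θ + t) = π • cosPartialSum F N θ := by
    have hzero := integral_cos_smul_comp_add hF hper heven 0 θ
    simp only [Nat.cast_zero, zero_mul, cos_zero, one_smul] at hzero
    simp only [trigDirichletKernel, add_smul, Finset.sum_smul]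
    rw [integral_add (Continuous.intervalIntegrable (by fun_prop) _ _)
      (Continuous.intervalIntegrable (by fun_prop) _ _),
      integral_finsetSum fun n _ => Continuous.intervalIntegrable (by fun_prop) _ _,
      intervalIntegral.integral_smul, hzero]
    simp only [integral_cos_smul_comp_add hF hper heven, cosPartialSum, smul_add,
      Finset.smul_sum, smul_comm π]
  simp only [smul_sub]
  rw [integral_sub (Continuous.intervalIntegrable (by fun_prop) _ _)
    (Continuous.intervalIntegrable (by fun_prop) _ _), hconv,
    intervalIntegral.integral_smul_const, integral_trigDirichletKernel, ← smul_sub,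
    inv_smul_smul₀ pi_ne_zero]

theorem trigDirichletKernel_smul {t : ℝ} {y : E} (ht : |t| ≤ π) (hy : t = 0 → y = 0) (N : ℕ) :
    trigDirichletKernel N t • y = sin ((N + 1 / 2) * t) • (2 * sin (t / 2))⁻¹ • y := by
  rcases eq_or_ne t 0 with h0 | h0
  · simp [hy h0]
  have hsin : sin (t / 2) ≠ 0 := fun h => by
    have := abs_le_pi_mul_abs_sin_half ht
    rw [h, abs_zero, mul_zero] at this
    exact h0 (abs_nonpos_iff.mp this)
  rw [← trigDirichletKernel_mul_two_mul_sin_half, smul_smul, mul_assoc,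
    mul_inv_cancel₀ (by positivity), mul_one]

theorem norm_integral_trigDirichletKernel_smul_le {y : ℝ → E} {C r : ℝ} (hr : 0 < r)
    (hy : ∀ t, ‖y t‖ ≤ C * |t| ^ r) (N : ℕ) :
    ‖∫ t in -π..π, trigDirichletKernel N t • y t‖ ≤
      ∫ t in -π..π, C * (π / 2) * |t| ^ (r - 1) := by
  refine norm_integral_le_of_norm_le (by linarith [pi_pos]) (ae_of_all _ fun t ht => ?_)
    ((intervalIntegrable_abs_rpow (by linarith) pi_pos.le).const_mul _)
  have ht' : |t| ≤ π := abs_le.mpr ⟨ht.1.le, ht.2⟩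
  have hzero : t = 0 → y t = 0 := by
    rintro rfl
    simpa [zero_rpow hr.ne'] using hy 0
  calc ‖trigDirichletKernel N t • y t‖
      = |sin ((N + 1 / 2) * t)| * ‖(2 * sin (t / 2))⁻¹ • y t‖ := by
        rw [trigDirichletKernel_smul ht' hzero, norm_smul, Real.norm_eq_abs]
    _ ≤ 1 * ‖(2 * sin (t / 2))⁻¹ • y t‖ := by gcongr; exact abs_sin_le_one _
    _ ≤ C * (π / 2) * |t| ^ (r - 1) := by
        rw [one_mul]
        exact norm_inv_two_mul_sin_half_smul_le ht'
          (by simpa using (norm_nonneg _).trans (hy 1)) (hy t)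

theorem equicontinuous_cosPartialSum_sub_self [CompleteSpace E] {F : ℝ → E} {C r : ℝ≥0}
    (hr : 0 < r) (hF : HolderWith C r F) (hper : Function.Periodic F (2 * π))
    (heven : Function.Even F) :
    Equicontinuous fun N θ => cosPartialSum F N θ - F θ := by
  have hcont : Continuous F := hF.continuous hr
  have hr2 : (0 : ℝ) < r / 2 := by positivity
  set I : ℝ := ∫ t in -π..π, |t| ^ (r / 2 - 1 : ℝ)
  refine Metric.equicontinuous_of_continuity_modulus
    (fun d => π⁻¹ * (2 * C * |d| ^ (r / 2 : ℝ) * (π / 2) * I)) ?_ _ fun θ θ' N => ?_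
  · have hmod : Continuous fun d : ℝ => π⁻¹ * (2 * C * |d| ^ (r / 2 : ℝ) * (π / 2) * I) := by
      have : Continuous fun d : ℝ => |d| ^ (r / 2 : ℝ) :=
        continuous_abs.rpow_const fun _ => Or.inr hr2.le
      fun_prop
    simpa [zero_rpow hr2.ne'] using hmod.tendsto 0
  · have hbound := norm_integral_trigDirichletKernel_smul_le hr2
      (norm_sub_sub_sub_le_of_holderWith hF θ θ') N
    rw [intervalIntegral.integral_const_mul] at hbound
    rw [dist_eq_norm, cosPartialSum_sub_self hcont hper heven,
      cosPartialSum_sub_self hcont hper heven, ← smul_sub, ← integral_sub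
        (Continuous.intervalIntegrable (by fun_prop) _ _)
        (Continuous.intervalIntegrable (by fun_prop) _ _), norm_smul, norm_inv,
      Real.norm_of_nonneg pi_pos.le, abs_dist, Real.dist_eq]
    simp only [← smul_sub]
    gcongr
    exact hbound

end Real

section Complex

variable [NormedSpace ℂ E]

theorem tendsto_integral_sin_mul_smul {f : ℝ → E} (hf : Integrable f) :
    Tendsto (fun w : ℝ => ∫ t, sin (w * t) • f t) atTop (𝓝 0) := by
  have hRL := Real.tendsto_integral_exp_smul_cocompact f
  have hpos : Tendsto (fun w : ℝ => w / (2 * π)) atTop (cocompact ℝ) :=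
    (tendsto_id.atTop_div_const (by positivity)).mono_right atTop_le_cocompact
  have hneg : Tendsto (fun w : ℝ => -w / (2 * π)) atTop (cocompact ℝ) :=
    (tendsto_neg_atTop_atBot.atBot_div_const (by positivity)).mono_right atBot_le_cocompact
  have hlim := ((hRL.comp hpos).sub (hRL.comp hneg)).const_smul (Complex.I / 2)
  rw [sub_zero, smul_zero] at hlim
  have hint (w : ℝ) : Integrable fun v : ℝ => fourierChar (-(v * w)) • f v :=
    by simpa [mul_comm] using (fourierIntegral_convergent_iff w).mpr hf
  refine hlim.congr fun w => ?_
  simp only [Function.comp_apply]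
  rw [← MeasureTheory.integral_sub (hint _) (hint _), ← MeasureTheory.integral_smul]
  refine integral_congr_ae (ae_of_all _ fun t => ?_)
  have hneg_arg : 2 * π * -(t * (w / (2 * π))) = -(w * t) := by field_simp
  have hpos_arg : 2 * π * -(t * (-w / (2 * π))) = w * t := by field_simp
  simp only [Circle.smul_def, fourierChar_apply, hneg_arg, hpos_arg]
  rw [← Complex.coe_smul, ← sub_smul, smul_smul, Complex.ofReal_sin, Complex.sin]
  push_cast
  ring_nf

variable [CompleteSpace E] {F : ℝ → E} {C r : ℝ≥0} (hr : 0 < r) (hF : HolderWith C r F)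
  (hper : Function.Periodic F (2 * π)) (heven : Function.Even F)
include hr hF hper heven

theorem tendsto_cosPartialSum (θ : ℝ) :
    Tendsto (fun N => cosPartialSum F N θ) atTop (𝓝 (F θ)) := by
  have hcont : Continuous F := hF.continuous hr
  have hle : -π ≤ π := by linarith [pi_pos]
  set q : ℝ → E := fun t => (2 * sin (t / 2))⁻¹ • (F (θ + t) - F θ)
  have hq : IntervalIntegrable q volume (-π) π := by
    refine ((intervalIntegrable_abs_rpow (r := r - 1) (by simpa) pi_pos.le).const_mul
      (C * (π / 2))).mono_fun' ?_ ?_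
    · have hmeas : Measurable fun t : ℝ => (2 * sin (t / 2))⁻¹ := by fun_prop
      exact hmeas.aestronglyMeasurable.smul (Continuous.aestronglyMeasurable (by fun_prop))
    · refine (ae_restrict_iff' measurableSet_uIoc).mpr (ae_of_all _ fun t ht => ?_)
      rw [Set.uIoc_of_le hle] at ht
      refine norm_inv_two_mul_sin_half_smul_le (abs_le.mpr ⟨ht.1.le, ht.2⟩) C.2 ?_
      simpa [dist_eq_norm] using hF.dist_le (θ + t) θ
  have hsin : Tendsto (fun N : ℕ => ∫ t in -π..π, sin ((N + 1 / 2) * t) • q t) atTop (𝓝 0) := by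
    rw [intervalIntegrable_iff_integrableOn_Ioc_of_le hle,
      ← integrable_indicator_iff measurableSet_Ioc] at hq
    have hhalf : Tendsto (fun N : ℕ => (N + 1 / 2 : ℝ)) atTop atTop :=
      tendsto_natCast_atTop_atTop.atTop_add tendsto_const_nhds
    refine ((tendsto_integral_sin_mul_smul hq).comp hhalf).congr fun N => ?_
    simp only [Function.comp_apply]
    rw [integral_of_le hle, ← MeasureTheory.integral_indicator measurableSet_Ioc]
    simp only [Set.indicator_smul]
  have hsub (N : ℕ) : cosPartialSum F N θ =
      F θ + π⁻¹ • ∫ t in -π..π, sin ((N + 1 / 2) * t) • q t := by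
    rw [← sub_eq_iff_eq_add', cosPartialSum_sub_self hcont hper heven]
    congr 1
    refine integral_congr fun t ht => ?_
    rw [Set.uIcc_of_le hle] at ht
    exact trigDirichletKernel_smul (abs_le.mpr ht) (by rintro rfl; simp) N
  simp only [hsub]
  simpa using (hsin.const_smul π⁻¹).const_add (F θ)

/-- The Dini–Lipschitz test for Hölder continuous functions. -/
theorem tendstoUniformly_cosPartialSum :
    TendstoUniformly (cosPartialSum F) F atTop := by
  have hIcc : TendstoUniformlyOn (fun N θ => cosPartialSum F N θ - F θ) (fun _ => 0) atTop
      (Set.Icc 0 (2 * π)) := by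
    have hequi := equicontinuous_cosPartialSum_sub_self hr hF hper heven
    have hpointwise (θ : ℝ) : Tendsto (fun N => cosPartialSum F N θ - F θ) atTop (𝓝 0) := by
      simpa using (tendsto_cosPartialSum hr hF hper heven θ).sub_const (F θ)
    refine UniformOnFun.tendsto_iff_tendstoUniformlyOn.mp
      ((EquicontinuousOn.tendsto_uniformOnFun_iff_pi' (𝔖 := {Set.Icc 0 (2 * π)})
        (by simpa using isCompact_Icc) (fun K _ => hequi.equicontinuousOn K) atTop
        (fun _ => 0)).mpr ?_) _ rfl
    exact tendsto_pi_nhds.mpr fun θ => hpointwise θ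
  rw [Metric.tendstoUniformlyOn_iff] at hIcc
  refine Metric.tendstoUniformly_iff.mpr fun ε hε => (hIcc ε hε).mono fun N hN θ => ?_
  obtain ⟨θ', hθ', hF'⟩ := ((periodic_cosPartialSum F N).sub hper).exists_mem_Ico₀ two_pi_pos θ
  rw [dist_comm, dist_eq_norm, ← Pi.sub_apply, hF']
  simpa only [dist_zero_left, Pi.sub_apply] using hN θ' (Set.Ico_subset_Icc_self hθ')

theorem tendsto_sum_cosCoeff :
    Tendsto (fun N => ∑ n ∈ Finset.range N, cosCoeff F (n + 1)) atTop
      (𝓝 (F 0 - (1 / 2 : ℝ) • cosCoeff F 0)) :=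
  ((tendsto_cosPartialSum hr hF hper heven 0).sub_const _).congr fun N => by
    simp [cosPartialSum]

theorem tendsto_sum_neg_one_pow_smul_cosCoeff :
    Tendsto (fun N => ∑ n ∈ Finset.range N, (-1 : ℝ) ^ n • cosCoeff F (n + 1)) atTop
      (𝓝 ((1 / 2 : ℝ) • cosCoeff F 0 - F π)) :=
  ((tendsto_cosPartialSum hr hF hper heven π).const_sub _).congr fun N => by
    simp only [cosPartialSum, cos_nat_mul_pi, pow_succ, mul_neg_one, neg_smul,
      Finset.sum_neg_distrib, ← sub_eq_add_neg, sub_sub_cancel]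

end Complex

end CosineSeries

section Tauberian

theorem tendsto_zero_of_tendsto_sum_range {G : Type*} [AddCommGroup G] [TopologicalSpace G]
    [IsTopologicalAddGroup G] {w : ℕ → G} {S : G}
    (hS : Tendsto (fun N => ∑ n ∈ Finset.range N, w n) atTop (𝓝 S)) : Tendsto w atTop (𝓝 0) := by
  have h := (hS.comp (tendsto_add_atTop_nat 1)).sub hS
  rw [sub_self] at h
  exact h.congr fun N => by simp [Finset.sum_range_succ]

variable {E : Type*} [NormedAddCommGroup E] [NormedSpace ℝ E] {w : ℕ → E} {S S' L L' : E}

/-- Kronecker's lemma for the weights `n`. -/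
theorem tendsto_inv_smul_sum_natCast_smul
    (hS : Tendsto (fun N => ∑ n ∈ Finset.range N, w n) atTop (𝓝 S)) :
    Tendsto (fun N : ℕ => (N : ℝ)⁻¹ • ∑ n ∈ Finset.range N, (n : ℝ) • w n) atTop (𝓝 0) := by
  set s : ℕ → E := fun N => ∑ n ∈ Finset.range N, w n with hs
  have hparts (N : ℕ) : ∑ n ∈ Finset.range N, (n : ℝ) • w n =
      (N : ℝ) • s N - ∑ n ∈ Finset.range N, s (n + 1) := by
    induction N with
    | zero => simp
    | succ N ih =>
      rw [Finset.sum_range_succ, Finset.sum_range_succ, ih, hs]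
      simp only [Finset.sum_range_succ, Nat.cast_succ]
      module
  have hmean := hS.sub (hS.comp (tendsto_add_atTop_nat 1)).cesaro_smul
  rw [sub_self] at hmean
  refine hmean.congr' ?_
  filter_upwards [eventually_ne_atTop 0] with N hN
  rw [hparts, smul_sub, inv_smul_smul₀ (Nat.cast_ne_zero.mpr hN)]
  rfl

theorem eq_zero_of_tendsto_natCast_smul_add_succ
    (hS : Tendsto (fun N => ∑ n ∈ Finset.range N, w n) atTop (𝓝 S))
    (hL : Tendsto (fun n : ℕ => (n : ℝ) • w n + (n + 1 : ℝ) • w (n + 1)) atTop (𝓝 L)) :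
    L = 0 := by
  have hsum (N : ℕ) : ∑ n ∈ Finset.range N, ((n : ℝ) • w n + (n + 1 : ℝ) • w (n + 1)) =
      (2 : ℝ) • (∑ n ∈ Finset.range N, (n : ℝ) • w n) + (N : ℝ) • w N := by
    induction N with
    | zero => simp
    | succ N ih =>
      rw [Finset.sum_range_succ, Finset.sum_range_succ, ih]
      push_cast
      module
  have hmean := ((tendsto_inv_smul_sum_natCast_smul hS).const_smul (2 : ℝ)).add
    (tendsto_zero_of_tendsto_sum_range hS)
  rw [smul_zero, add_zero] at hmean
  refine tendsto_nhds_unique (hL.cesaro_smul.congr' ?_) hmean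
  filter_upwards [eventually_ne_atTop 0] with N hN
  rw [hsum, smul_add, inv_smul_smul₀ (Nat.cast_ne_zero.mpr hN), smul_comm]

theorem tendsto_natCast_smul_of_tendsto_add_succ
    (hS : Tendsto (fun N => ∑ n ∈ Finset.range N, w n) atTop (𝓝 S))
    (hS' : Tendsto (fun N => ∑ n ∈ Finset.range N, (-1 : ℝ) ^ n • w n) atTop (𝓝 S'))
    (hL : Tendsto (fun n : ℕ => (n : ℝ) • w n + (n + 1 : ℝ) • w (n + 1)) atTop (𝓝 L))
    (hL' : Tendsto (fun n : ℕ => (n : ℝ) • (-1 : ℝ) ^ n • w n +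
      (n + 1 : ℝ) • (-1 : ℝ) ^ (n + 1) • w (n + 1)) atTop (𝓝 L')) :
    Tendsto (fun n : ℕ => (n : ℝ) • w n) atTop (𝓝 0) := by
  rw [eq_zero_of_tendsto_natCast_smul_add_succ hS hL] at hL
  rw [eq_zero_of_tendsto_natCast_smul_add_succ hS' hL', tendsto_zero_iff_norm_tendsto_zero] at hL'
  have hdiff : Tendsto (fun n : ℕ => (n : ℝ) • w n - (n + 1 : ℝ) • w (n + 1)) atTop (𝓝 0) := by
    refine tendsto_zero_iff_norm_tendsto_zero.mpr (hL'.congr fun n => ?_)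
    have hsign : (n : ℝ) • (-1 : ℝ) ^ n • w n + (n + 1 : ℝ) • (-1 : ℝ) ^ (n + 1) • w (n + 1) =
        (-1 : ℝ) ^ n • ((n : ℝ) • w n - (n + 1 : ℝ) • w (n + 1)) := by
      rw [pow_succ]
      module
    rw [hsign, norm_smul, norm_pow, norm_neg, norm_one, one_pow, one_mul]
  have hhalf := (hL.add hdiff).const_smul (1 / 2 : ℝ)
  rw [add_zero, smul_zero] at hhalf
  exact hhalf.congr fun n => by module

end Tauberian

section Chebyshev

open Polynomial.Chebyshev

theorem abs_eval_U_mul_sqrt_le_one (n : ℤ) {t : ℝ} (ht : t ∈ Set.Icc (-1 : ℝ) 1) :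
    |(U ℝ n).eval t| * √(1 - t ^ 2) ≤ 1 := by
  have h := U_real_cos (Real.arccos t) n
  rw [Real.cos_arccos ht.1 ht.2, Real.sin_arccos] at h
  rw [← abs_of_nonneg (Real.sqrt_nonneg (1 - t ^ 2)), ← abs_mul, h]
  exact Real.abs_sin_le_one _

theorem abs_eval_U_natCast_sub_one_le (n : ℕ) {t : ℝ} (ht : t ∈ Set.Icc (-1 : ℝ) 1) :
    |(U ℝ (n - 1)).eval t| ≤ n := by
  induction n with
  | zero => simp
  | succ n ih =>
    have hT : |(T ℝ n).eval t| ≤ 1 := by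
      rw [← Real.cos_arccos ht.1 ht.2, T_real_cos]
      exact Real.abs_cos_le_one _
    have hrec : (U ℝ n).eval t = t * (U ℝ (n - 1)).eval t + (T ℝ n).eval t := by
      simpa using congrArg (Polynomial.eval t) (U_eq_X_mul_U_add_T ℝ (n - 1))
    rw [Nat.cast_succ, add_sub_cancel_right, hrec]
    calc |t * (U ℝ (n - 1)).eval t + (T ℝ n).eval t|
        ≤ |t| * |(U ℝ (n - 1)).eval t| + |(T ℝ n).eval t| := by
          rw [← abs_mul]
          exact abs_add_le _ _
      _ ≤ 1 * n + 1 := by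
          gcongr
          exact abs_le.mpr ht
      _ = (n + 1 : ℕ) := by push_cast; ring

/-- Summation by parts with `2 T_n = U_n - U_{n-2}`. -/
theorem sum_eval_U_smul_sub {E : Type*} [AddCommGroup E] [Module ℝ E] (a : ℕ → E) (N : ℕ)
    (t : ℝ) :
    ∑ n ∈ Finset.range (N + 1), (U ℝ n).eval t • (1 / 2 : ℝ) • (a n - a (n + 2)) =
      (1 / 2 : ℝ) • a 0 + ∑ n ∈ Finset.range N, (T ℝ (n + 1 : ℕ)).eval t • a (n + 1) -
        (1 / 2 : ℝ) • ((U ℝ (N - 1)).eval t • a (N + 1) + (U ℝ N).eval t • a (N + 2)) := by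
  induction N with
  | zero =>
    simp only [zero_add, Finset.range_one, Finset.sum_singleton, Finset.range_zero,
      Finset.sum_empty, Nat.cast_zero, U_zero, Polynomial.eval_one, one_smul, add_zero, zero_sub,
      U_neg_one, Polynomial.eval_zero, zero_smul]
    module
  | succ N ih =>
    have hT : (U ℝ (N + 1 : ℕ)).eval t =
        2 * (T ℝ (N + 1 : ℕ)).eval t + (U ℝ (N - 1)).eval t := by
      have h := congrArg (Polynomial.eval t) (two_mul_T_eq_U_sub_U ℝ (N - 1))
      rw [show (N : ℤ) - 1 + 2 = (N + 1 : ℕ) by push_cast; ring] at h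
      simp only [Polynomial.eval_sub, Polynomial.eval_mul, Polynomial.eval_ofNat] at h
      linarith
    rw [Finset.sum_range_succ, ih, Finset.sum_range_succ, hT, Nat.cast_succ, add_sub_cancel_right]
    module

end Chebyshev

section PolynomialMoments

open Polynomial

theorem integrable_of_ae_mem_Icc {E : Type*} [NormedAddCommGroup E] {μ : Measure ℝ}
    [IsFiniteMeasure μ] {a b : ℝ} (hμ : ∀ᵐ x ∂μ, x ∈ Set.Icc a b) {g : ℝ → E}
    (hg : Continuous g) : Integrable g μ := by
  obtain ⟨C, hC⟩ := isCompact_Icc.exists_bound_of_continuousOn hg.continuousOn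
  exact .of_bound hg.aestronglyMeasurable C (hμ.mono hC)

variable {μ ν : Measure ℝ} [IsFiniteMeasure μ] [IsFiniteMeasure ν] {a b : ℝ}

theorem abs_integral_sub_integral_le (hμ : ∀ᵐ x ∂μ, x ∈ Set.Icc a b) {f g : ℝ → ℝ}
    (hf : Continuous f) (hg : Continuous g) {ε : ℝ} (h : ∀ x ∈ Set.Icc a b, |f x - g x| ≤ ε) :
    |∫ x, f x ∂μ - ∫ x, g x ∂μ| ≤ ε * μ.real Set.univ := by
  rw [← integral_sub (integrable_of_ae_mem_Icc hμ hf) (integrable_of_ae_mem_Icc hμ hg)]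
  simp only [← Real.norm_eq_abs] at h ⊢
  exact norm_integral_le_of_norm_le_const (hμ.mono h)

theorem measure_ext_of_forall_integral_eval_eq (hμ : ∀ᵐ x ∂μ, x ∈ Set.Icc a b)
    (hν : ∀ᵐ x ∂ν, x ∈ Set.Icc a b) (h : ∀ p : ℝ[X], ∫ x, p.eval x ∂μ = ∫ x, p.eval x ∂ν) :
    μ = ν := by
  refine ext_of_forall_integral_eq_of_IsFiniteMeasure fun f => ?_
  have hbound (ε : ℝ) (hε : 0 < ε) : |∫ x, f x ∂μ - ∫ x, f x ∂ν| ≤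
      ε * (μ.real Set.univ + ν.real Set.univ) := by
    obtain ⟨p, hp⟩ := exists_polynomial_near_of_continuousOn a b f f.continuous.continuousOn ε hε
    have hle (x : ℝ) (hx : x ∈ Set.Icc a b) : |p.eval x - f x| ≤ ε := (hp x hx).le
    rw [mul_add]
    refine (abs_sub_le _ (∫ x, p.eval x ∂μ) _).trans (add_le_add ?_ ?_)
    · rw [abs_sub_comm]
      exact abs_integral_sub_integral_le hμ p.continuous f.continuous hle
    · rw [h]
      exact abs_integral_sub_integral_le hν p.continuous f.continuous hle
  have hlim : Tendsto (fun ε => ε * (μ.real Set.univ + ν.real Set.univ)) (𝓝[>] 0) (𝓝 0) :=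
    tendsto_nhdsWithin_of_tendsto_nhds (Continuous.tendsto' (by fun_prop) _ _ (zero_mul _))
  have hzero := ge_of_tendsto hlim (eventually_mem_nhdsWithin.mono hbound)
  exact sub_eq_zero.mp (abs_nonpos_iff.mp hzero)

theorem measure_ext_of_span_eq_top (hμ : ∀ᵐ x ∂μ, x ∈ Set.Icc a b)
    (hν : ∀ᵐ x ∂ν, x ∈ Set.Icc a b) {S : Set ℝ[X]} (hS : Submodule.span ℝ S = ⊤)
    (h : ∀ p ∈ S, ∫ x, p.eval x ∂μ = ∫ x, p.eval x ∂ν) : μ = ν := by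
  refine measure_ext_of_forall_integral_eval_eq hμ hν fun p => ?_
  have hp : p ∈ Submodule.span ℝ S := hS ▸ Submodule.mem_top
  induction hp using Submodule.span_induction with
  | mem p hp => exact h p hp
  | zero => simp only [eval_zero, integral_zero]
  | add p q _ _ hp hq =>
    simp only [eval_add]
    rw [integral_add (integrable_of_ae_mem_Icc hμ p.continuous)
      (integrable_of_ae_mem_Icc hμ q.continuous), hp, hq, integral_add
      (integrable_of_ae_mem_Icc hν p.continuous) (integrable_of_ae_mem_Icc hν q.continuous)]
  | smul c p _ hp => simp only [eval_smul, integral_smul, hp]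

theorem span_range_chebyshevU :
    Submodule.span ℝ (Set.range fun n : ℕ => Chebyshev.U ℝ n) = ⊤ :=
  Sequence.span ⟨_, Chebyshev.degree_U_natCast ℝ⟩ fun n => by
    change IsUnit (Chebyshev.U ℝ n).leadingCoeff
    rw [Chebyshev.leadingCoeff_U_natCast]
    exact (pow_ne_zero n two_ne_zero).isUnit

end PolynomialMoments

section BinaryForms

open MvPolynomial

variable (R : Type*) [CommSemiring R] (n : ℕ)

/-- The exponents of total degree `n` in two variables, enumerated by the exponent of `X 0`. -/
noncomputable def binaryExponentEquiv : Fin (n + 1) ≃ {d : Fin 2 →₀ ℕ | d.degree = n} where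
  toFun j := ⟨Finsupp.single 0 (j : ℕ) + Finsupp.single 1 (n - j : ℕ), by
    rw [Set.mem_ofPred_eq, map_add, Finsupp.degree_single, Finsupp.degree_single]
    lia⟩
  invFun d := ⟨d.1 0, by
    have hd : d.1 0 + d.1 1 = n := by simpa [Finsupp.degree_eq_sum] using d.2
    lia⟩
  left_inv j := by simp
  right_inv d := by
    have hd : d.1 0 + d.1 1 = n := by simpa [Finsupp.degree_eq_sum] using d.2
    ext i
    fin_cases i
    · simp
    · simp [← hd]

/-- The monomials `X₀ ^ j X₁ ^ (n - j)` as a basis of the binary forms of degree `n`. -/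
noncomputable def binaryFormBasis :
    Module.Basis (Fin (n + 1)) R (homogeneousSubmodule (Fin 2) R n) :=
  ((basisRestrictSupport R {d | d.degree = n}).map (LinearEquiv.ofEq _ _
    (homogeneousSubmodule_eq_finsupp_supported _ R n).symm)).reindex (binaryExponentEquiv n).symm

theorem binaryFormBasis_repr_apply (p : homogeneousSubmodule (Fin 2) R n) (j : Fin (n + 1)) :
    (binaryFormBasis R n).repr p j = coeff (binaryExponentEquiv n j) p.val := by
  rw [binaryFormBasis, Module.Basis.repr_reindex_apply]
  rfl

theorem monomial_binaryExponentEquiv (j : Fin (n + 1)) :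
    monomial (binaryExponentEquiv n j).1 (1 : R) = X 0 ^ (j : ℕ) * X 1 ^ (n - j : ℕ) := by
  rw [X_pow_eq_monomial, X_pow_eq_monomial, monomial_mul, one_mul]
  rfl

theorem coeff_binaryExponentEquiv (i j : Fin (n + 1)) :
    coeff (binaryExponentEquiv n i) (X 0 ^ (j : ℕ) * X 1 ^ (n - j : ℕ) : MvPolynomial (Fin 2) R) =
      if i = j then 1 else 0 := by
  classical
  rw [← monomial_binaryExponentEquiv, coeff_monomial]
  simp [Subtype.coe_inj, eq_comm]

theorem coe_binaryFormBasis (j : Fin (n + 1)) :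
    (binaryFormBasis R n j : MvPolynomial (Fin 2) R) = X 0 ^ (j : ℕ) * X 1 ^ (n - j : ℕ) := by
  have hmem := isHomogeneous_monomial (1 : R) (binaryExponentEquiv n j).2
  have hb : binaryFormBasis R n j =
      ⟨monomial (binaryExponentEquiv n j).1 1, (mem_homogeneousSubmodule n _).mpr hmem⟩ := by
    refine Module.Basis.apply_eq_iff.mpr (Finsupp.ext fun i => ?_)
    simp only [binaryFormBasis_repr_apply, monomial_binaryExponentEquiv, coeff_binaryExponentEquiv,
      Finsupp.single_apply, eq_comm]
  rw [← monomial_binaryExponentEquiv]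
  exact congrArg Subtype.val hb

end BinaryForms

theorem sum_pow_mul_pow_eq_eval_U {R : Type*} [CommRing R] {z w c : R} (hzw : z * w = 1)
    (hc : z + w = 2 * c) (n : ℕ) :
    ∑ j ∈ Finset.range (n + 1), z ^ j * w ^ (n - j) = (Polynomial.Chebyshev.U R n).eval c := by
  induction n using Nat.twoStepInduction with
  | zero => simp
  | one => simpa [Finset.sum_range_succ, add_comm] using hc
  | more n ih₀ ih₁ =>
    have h₁ := geom_sum₂_succ_eq z w (n := n + 1)
    have h₂ := geom_sum₂_succ_eq z w (n := n + 2)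
    simp only [Nat.add_succ_sub_one] at h₁ h₂
    push_cast at ih₁ ⊢
    rw [Polynomial.Chebyshev.U_add_two, Polynomial.eval_sub, Polynomial.eval_mul,
      Polynomial.eval_mul, Polynomial.eval_X, Polynomial.eval_ofNat, ← hc, ← ih₀, ← ih₁, h₂]
    linear_combination -z * h₁ - (∑ j ∈ Finset.range (n + 1), z ^ j * w ^ (n - j)) * hzw

section DiagonalCommutant

open Matrix

variable {n R : Type*} [Fintype n] [DecidableEq n] [CommRing R] [IsDomain R] {d : n → R}
  {A B : Matrix n n R}

theorem eq_diagonal_of_commute_diagonal (hd : Function.Injective d)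
    (h : Commute (diagonal d) A) : A = diagonal A.diag := by
  ext i j
  have hij := congrFun₂ h.eq i j
  rw [diagonal_mul, mul_diagonal, mul_comm, ← sub_eq_zero, ← mul_sub, mul_eq_zero,
    sub_eq_zero] at hij
  obtain rfl | hne := eq_or_ne i j
  · simp
  · simpa [hne] using hij.resolve_right (hd.ne hne)

theorem eq_of_commute_diagonal_of_ne_zero (h : Commute (diagonal d) B) {i j : n} (hB : B i j ≠ 0) :
    d i = d j := by
  have hij := congrFun₂ h.eq i j
  rw [diagonal_mul, mul_diagonal, mul_comm] at hij
  exact mul_left_cancel₀ hB hij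

theorem eq_smul_one_of_commute (hd : Function.Injective d) (hA : Commute (diagonal d) A)
    {j : n} (hB : ∀ i, B i j ≠ 0) (hAB : Commute A B) : A = A j j • (1 : Matrix n n R) := by
  have hdiag := eq_diagonal_of_commute_diagonal hd hA
  rw [hdiag] at hAB
  rw [smul_one_eq_diagonal]
  refine hdiag.trans (congrArg diagonal (funext fun i => ?_))
  exact eq_of_commute_diagonal_of_ne_zero hAB (hB i)

end DiagonalCommutant

/-- A function on a group that is constant on conjugacy classes, in the form `f (x y) = f (y x)`. -/
def IsClassFunction {G R : Type*} [Mul G] (f : G → R) : Prop :=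
  ∀ x y, f (x * y) = f (y * x)

theorem IsClassFunction.eq_of_isConj {G R : Type*} [Group G] {f : G → R} (hf : IsClassFunction f)
    {x y : G} (h : IsConj x y) : f x = f y := by
  obtain ⟨c, rfl⟩ := isConj_iff.mp h
  rw [hf, inv_mul_cancel_left]

namespace SU2

open Complex ComplexConjugate
open scoped Matrix

theorem star_val_eq_adjugate (x : SU2) : star x.val = x.val.adjugate := by
  have hx := Matrix.mem_specialUnitaryGroup_iff.mp x.2
  exact left_inv_eq_right_inv (Matrix.mem_unitaryGroup_iff'.mp hx.1)
    (by rw [Matrix.mul_adjugate, hx.2, one_smul])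

theorem val_one_one (x : SU2) : x.val 1 1 = conj (x.val 0 0) := by
  simpa [Matrix.adjugate_fin_two] using (congrFun₂ (star_val_eq_adjugate x) 0 0).symm

theorem val_zero_one (x : SU2) : x.val 0 1 = -conj (x.val 1 0) := by
  have h := congrFun₂ (star_val_eq_adjugate x) 0 1
  simp only [Matrix.star_apply, Matrix.adjugate_fin_two, Matrix.of_apply, Matrix.cons_val',
    Matrix.cons_val_zero, Matrix.cons_val_one, Matrix.cons_val_fin_one] at h
  rw [← neg_eq_iff_eq_neg, ← h]
  rfl

theorem ext_of_firstColumn_eq {x y : SU2} (h₀ : x.val 0 0 = y.val 0 0)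
    (h₁ : x.val 1 0 = y.val 1 0) : x = y := by
  refine Subtype.ext (Matrix.ext fun i j => ?_)
  fin_cases i <;> fin_cases j <;> simp [val_one_one, val_zero_one, h₀, h₁]

/-- The element of `SU(2)` with first column `(a, b)`. -/
noncomputable def ofFirstColumn (a b : ℂ) (h : normSq a + normSq b = 1) : SU2 :=
  ⟨!![a, -conj b; b, conj a], by
    have hab : a * conj a + b * conj b = 1 := by
      rw [mul_conj, mul_conj]
      exact_mod_cast h
    refine Matrix.mem_specialUnitaryGroup_iff.mpr ⟨Matrix.mem_unitaryGroup_iff.mpr ?_, ?_⟩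
    · ext i j
      fin_cases i <;> fin_cases j <;>
        simp [Matrix.mul_apply, mul_comm] <;> linear_combination hab
    · rw [Matrix.det_fin_two_of]
      linear_combination hab⟩

/-- The maximal torus `θ ↦ diag(e^{iθ}, e^{-iθ})` of `SU(2)`. -/
noncomputable def torus (θ : ℝ) : SU2 :=
  ofFirstColumn (exp (θ * I)) 0 (by simp [normSq_eq_norm_sq, norm_exp_ofReal_mul_I])

theorem torus_val (θ : ℝ) : (torus θ).val = !![exp (θ * I), 0; 0, exp (-(θ * I))] := by
  have hconj : conj (exp (θ * I)) = exp (-(θ * I)) := by simp [← exp_conj]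
  simp [torus, ofFirstColumn, hconj]

theorem torus_zero : torus 0 = 1 :=
  ext_of_firstColumn_eq (by simp [torus_val]) (by simp [torus_val])

theorem torus_pi : torus Real.pi = negOne :=
  ext_of_firstColumn_eq (by simp [torus_val, negOne]) (by simp [torus_val, negOne])

@[fun_prop]
theorem continuous_torus : Continuous torus := by
  refine Continuous.subtype_mk (f := fun θ => (torus θ).val) ?_ _
  simp only [torus_val]
  refine continuous_matrix fun i j => ?_
  fin_cases i <;> fin_cases j
  · exact (by fun_prop : Continuous fun θ : ℝ => exp (θ * I))
  · exact continuous_const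
  · exact continuous_const
  · exact (by fun_prop : Continuous fun θ : ℝ => exp (-(θ * I)))

/-- Half of the (real) trace, which is `cos θ` on the conjugacy class of `torus θ`. -/
noncomputable def halfTrace (x : SU2) : ℝ := x.val.trace.re / 2

theorem trace_val (x : SU2) : x.val.trace = 2 * halfTrace x := by
  rw [halfTrace, Matrix.trace_fin_two, val_one_one, add_conj, ofReal_re]
  push_cast
  ring

@[fun_prop]
theorem continuous_halfTrace : Continuous halfTrace :=
  (continuous_re.comp continuous_subtype_val.matrix_trace).div_const 2

theorem halfTrace_mem_Icc (x : SU2) : halfTrace x ∈ Set.Icc (-1 : ℝ) 1 := by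
  have hentry (i : Fin 2) : |(x.val i i).re| ≤ 1 :=
    (abs_re_le_norm _).trans
      (entry_norm_bound_of_unitary (Matrix.mem_specialUnitaryGroup_iff.mp x.2).1 i i)
  have h₀ := abs_le.mp (hentry 0)
  have h₁ := abs_le.mp (hentry 1)
  rw [halfTrace, Matrix.trace_fin_two, add_re]
  constructor <;> linarith

theorem cos_arccos_halfTrace (x : SU2) : Real.cos (Real.arccos (halfTrace x)) = halfTrace x :=
  Real.cos_arccos (halfTrace_mem_Icc x).1 (halfTrace_mem_Icc x).2

@[simp]
theorem halfTrace_torus (θ : ℝ) : halfTrace (torus θ) = Real.cos θ := by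
  rw [halfTrace, torus_val, Matrix.trace_fin_two_of, add_re, ← neg_mul, ← ofReal_neg,
    exp_ofReal_mul_I_re, exp_ofReal_mul_I_re, Real.cos_neg]
  ring

theorem exists_smul_eq_firstColumn {v : Fin 2 → ℂ} (hv : v ≠ 0) :
    ∃ (g : SU2) (c : ℂ), c • v = g.val.col 0 := by
  have hpos : 0 < normSq (v 0) + normSq (v 1) := by
    refine lt_of_le_of_ne (add_nonneg (normSq_nonneg _) (normSq_nonneg _)) fun h => hv ?_
    obtain ⟨h₀, h₁⟩ := (add_eq_zero_iff_of_nonneg (normSq_nonneg _) (normSq_nonneg _)).mp h.symm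
    ext i
    fin_cases i
    exacts [normSq_eq_zero.mp h₀, normSq_eq_zero.mp h₁]
  set r : ℝ := √(normSq (v 0) + normSq (v 1))
  have hr2 : r * r = normSq (v 0) + normSq (v 1) := Real.mul_self_sqrt hpos.le
  refine ⟨ofFirstColumn ((r : ℂ)⁻¹ * v 0) ((r : ℂ)⁻¹ * v 1) ?_, (r : ℂ)⁻¹, ?_⟩
  · rw [normSq_mul, normSq_mul, ← mul_add, normSq_inv, normSq_ofReal, hr2,
      inv_mul_cancel₀ hpos.ne']
  · ext i
    fin_cases i <;> simp [ofFirstColumn]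

theorem isConj_torus {x : SU2} {θ : ℝ} (h : Real.cos θ = halfTrace x) : IsConj (torus θ) x := by
  have hdet : (x.val - exp (θ * I) • 1).det = 0 := by
    have hx := (Matrix.mem_specialUnitaryGroup_iff.mp x.2).2
    have htr := trace_val x
    have hcos := two_cos (θ : ℂ)
    have hexp : exp (θ * I) * exp (-(θ : ℂ) * I) = 1 := by rw [← exp_add]; simp
    rw [← h, ofReal_cos, hcos, Matrix.trace_fin_two] at htr
    rw [Matrix.det_fin_two] at hx
    simp only [Matrix.det_fin_two, Matrix.sub_apply, Matrix.smul_apply, Matrix.one_apply_eq,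
      Matrix.one_apply_ne, ne_eq, zero_ne_one, one_ne_zero, not_false_eq_true, smul_eq_mul,
      mul_one, mul_zero, sub_zero]
    linear_combination hx - exp (θ * I) * htr - hexp
  obtain ⟨v, hv, hker⟩ := Matrix.exists_mulVec_eq_zero_iff.mpr hdet
  rw [Matrix.sub_mulVec, Matrix.smul_mulVec, Matrix.one_mulVec, sub_eq_zero] at hker
  obtain ⟨g, c, hg⟩ := exists_smul_eq_firstColumn hv
  have heig : x.val *ᵥ g.val.col 0 = exp (θ * I) • g.val.col 0 := by
    rw [← hg, Matrix.mulVec_smul, hker, smul_comm]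
  have hcol (i : Fin 2) : (g * torus θ).val i 0 = (x * g).val i 0 :=
    calc (g * torus θ).val i 0 = exp (θ * I) * g.val i 0 := by
          simp [Matrix.mul_apply, torus_val, mul_comm]
      _ = (x * g).val i 0 := (congrFun heig i).symm
  exact isConj_iff.mpr ⟨g, mul_inv_eq_iff_eq_mul.mpr (ext_of_firstColumn_eq (hcol 0) (hcol 1))⟩

theorem halfTrace_inv (x : SU2) : halfTrace x⁻¹ = halfTrace x := by
  change (star x.val).trace.re / 2 = x.val.trace.re / 2
  rw [Matrix.star_eq_conjTranspose, Matrix.trace_conjTranspose, star_def, conj_re]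

theorem eq_one_or_eq_negOne_of_halfTrace_sq_eq_one {x : SU2} (h : halfTrace x ^ 2 = 1) :
    x = 1 ∨ x = negOne := by
  have hcenter (c : SU2) : c * negOne = negOne * c := Subtype.ext <| by simp [negOne]
  refine (_root_.sq_eq_one_iff.mp h).imp (fun h => ?_) fun h => ?_
  · exact isConj_one_right.mp (torus_zero ▸ isConj_torus (by rw [h, Real.cos_zero]))
  · obtain ⟨c, hc⟩ := isConj_iff.mp (isConj_torus (θ := Real.pi) (by rw [h, Real.cos_pi]))
    rw [← hc, torus_pi, hcenter, mul_inv_cancel_right]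

section ClassFunction

variable {R : Type*} {f : SU2 → R}

theorem apply_torus_eq (hf : IsClassFunction f) {x : SU2} {θ : ℝ}
    (h : Real.cos θ = halfTrace x) : f (torus θ) = f x :=
  hf.eq_of_isConj (isConj_torus h)

theorem apply_inv (hf : IsClassFunction f) (x : SU2) : f x⁻¹ = f x := by
  have hcos := cos_arccos_halfTrace x
  rw [← apply_torus_eq hf hcos, apply_torus_eq hf (hcos.trans (halfTrace_inv x).symm)]

theorem even_comp_torus (hf : IsClassFunction f) : Function.Even (f ∘ torus) := fun θ =>
  apply_torus_eq hf (by rw [halfTrace_torus, Real.cos_neg])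

theorem periodic_comp_torus (hf : IsClassFunction f) :
    Function.Periodic (f ∘ torus) (2 * Real.pi) := fun θ =>
  apply_torus_eq hf (by rw [halfTrace_torus, Real.cos_add_two_pi])

end ClassFunction

section Distance

theorem continuous_distance (y : SU2) : Continuous fun x => distance x y := by
  have h : Continuous fun x : SU2 => x.val - y.val := continuous_subtype_val.sub continuous_const
  exact Real.continuous_sqrt.comp
    (continuous_const.mul (continuous_re.comp (h.mul h.star).matrix_trace))

theorem distance_self (x : SU2) : distance x x = 0 := by
  simp [distance]

theorem distance_torus (s t : ℝ) :
    distance (torus s) (torus t) = ‖exp (s * I) - exp (t * I)‖ := by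
  set z := exp (s * I) - exp (t * I) with hz
  have hsub : (torus s).val - (torus t).val = !![z, 0; 0, conj z] := by
    ext i j
    fin_cases i <;> fin_cases j <;> simp [torus_val, hz, ← exp_conj]
  have hmul : !![z, 0; 0, conj z] * star !![z, 0; 0, conj z] =
      !![(normSq z : ℂ), 0; 0, normSq z] := by
    rw [Matrix.star_eq_conjTranspose, ← mul_conj]
    ext i j
    fin_cases i <;> fin_cases j <;> simp [Matrix.mul_apply, mul_comm]
  rw [distance, hsub, hmul, Matrix.trace_fin_two_of, norm_def, add_re, ofReal_re]
  ring_nf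

theorem distance_torus_le (s t : ℝ) : distance (torus s) (torus t) ≤ dist s t :=
  calc distance (torus s) (torus t) = ‖exp (s * I) - exp (t * I)‖ := distance_torus s t
    _ = ‖exp (t * I) * (exp (I * (s - t : ℝ)) - 1)‖ := by
        rw [mul_sub, mul_one, ← exp_add]
        push_cast
        ring_nf
    _ ≤ dist s t := by
        rw [norm_mul, norm_exp_ofReal_mul_I, one_mul, Real.dist_eq]
        exact Real.norm_exp_I_mul_ofReal_sub_one_le

variable {E : Type*} [SeminormedAddCommGroup E] {f : SU2 → E} {M α : ℝ}

theorem continuous_of_norm_sub_le_distance_rpow (hα : 0 < α)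
    (hf : ∀ x y, ‖f x - f y‖ ≤ M * distance x y ^ α) : Continuous f := by
  refine continuous_iff_continuousAt.mpr fun x => tendsto_iff_norm_sub_tendsto_zero.mpr ?_
  refine squeeze_zero (fun _ => norm_nonneg _) (fun y => hf y x) ?_
  have hcont : Continuous fun y => M * distance y x ^ α :=
    continuous_const.mul ((continuous_distance x).rpow_const fun _ => Or.inr hα.le)
  simpa [distance_self, Real.zero_rpow hα.ne'] using hcont.tendsto x

theorem holderWith_comp_torus (hα : 0 ≤ α)
    (hf : ∀ x y, ‖f x - f y‖ ≤ M * distance x y ^ α) :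
    HolderWith M.toNNReal α.toNNReal (f ∘ torus) := fun s t => by
  rw [edist_dist, edist_dist, Real.coe_toNNReal α hα,
    ENNReal.ofReal_rpow_of_nonneg dist_nonneg hα, ← ENNReal.ofReal_coe_nnreal,
    ← ENNReal.ofReal_mul M.toNNReal.coe_nonneg, Real.coe_toNNReal']
  refine ENNReal.ofReal_le_ofReal ?_
  calc dist (f (torus s)) (f (torus t)) ≤ M * distance (torus s) (torus t) ^ α := by
        rw [dist_eq_norm]
        exact hf _ _
    _ ≤ max M 0 * dist s t ^ α := by
        have hdist : 0 ≤ distance (torus s) (torus t) := Real.sqrt_nonneg _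
        gcongr
        · exact le_max_left M 0
        · exact distance_torus_le s t

end Distance

section Irrep

open MvPolynomial

/-- The matrix of `π_n(x)` in the monomial basis. -/
noncomputable def irrepMatrix (n : ℕ) (x : SU2) : Matrix (Fin (n + 1)) (Fin (n + 1)) ℂ :=
  LinearMap.toMatrix (binaryFormBasis ℂ n) (binaryFormBasis ℂ n) (irrep n x)

theorem irrepMatrix_mul (n : ℕ) (x y : SU2) :
    irrepMatrix n (x * y) = irrepMatrix n x * irrepMatrix n y := by
  rw [irrepMatrix, map_mul, LinearMap.toMatrix_mul, irrepMatrix, irrepMatrix]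

theorem trace_irrepMatrix (n : ℕ) (x : SU2) : (irrepMatrix n x).trace = character n x :=
  (LinearMap.trace_eq_matrix_trace ℂ (binaryFormBasis ℂ n) _).symm

theorem irrepMatrix_apply (n : ℕ) (x : SU2) (i j : Fin (n + 1)) :
    irrepMatrix n x i j =
      coeff (binaryExponentEquiv n i) (subst x (X 0 ^ (j : ℕ) * X 1 ^ (n - j : ℕ))) := by
  rw [← coe_binaryFormBasis, irrepMatrix, LinearMap.toMatrix_apply, binaryFormBasis_repr_apply]
  rfl

theorem subst_X (x : SU2) (j : Fin 2) :
    subst x (X j) = C (x.val 0 j) * X 0 + C (x.val 1 j) * X 1 := by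
  simp [subst, Fin.sum_univ_two]

theorem irrepMatrix_torus (n : ℕ) (θ : ℝ) :
    irrepMatrix n (torus θ) = Matrix.diagonal fun j : Fin (n + 1) =>
      exp (θ * I) ^ (j : ℕ) * exp (-(θ * I)) ^ (n - j : ℕ) := by
  ext i j
  have h₀ : subst (torus θ) (X 0) = C (exp (θ * I)) * X 0 := by simp [subst_X, torus_val]
  have h₁ : subst (torus θ) (X 1) = C (exp (-(θ * I))) * X 1 := by simp [subst_X, torus_val]
  rw [irrepMatrix_apply, map_mul, map_pow, map_pow, h₀, h₁, mul_pow, mul_pow, mul_mul_mul_comm,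
    ← C_pow, ← C_pow, ← C_mul, coeff_C_mul, coeff_binaryExponentEquiv, Matrix.diagonal_apply,
    mul_ite, mul_one, mul_zero]
  obtain rfl | hij := eq_or_ne i j
  · rfl
  · rw [if_neg hij, if_neg hij]

theorem irrepMatrix_last (n : ℕ) (x : SU2) (i : Fin (n + 1)) :
    irrepMatrix n x i (Fin.last n) =
      n.choose i * x.val 0 0 ^ (i : ℕ) * x.val 1 0 ^ (n - i : ℕ) := by
  have hterm (j : Fin (n + 1)) : (C (x.val 0 0) * X 0) ^ (j : ℕ) * (C (x.val 1 0) * X 1) ^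
      (n - j : ℕ) * (n.choose j : MvPolynomial (Fin 2) ℂ) =
      C (n.choose j * x.val 0 0 ^ (j : ℕ) * x.val 1 0 ^ (n - j : ℕ)) *
        (X 0 ^ (j : ℕ) * X 1 ^ (n - j : ℕ)) := by
    simp only [map_mul, map_pow, map_natCast]
    ring
  rw [irrepMatrix_apply, Fin.val_last, Nat.sub_self, pow_zero, mul_one, map_pow, subst_X, add_pow,
    Finset.sum_range, coeff_sum]
  simp only [hterm, coeff_C_mul, coeff_binaryExponentEquiv, mul_ite, mul_one, mul_zero,
    Finset.sum_ite_eq, Finset.mem_univ, if_true]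

theorem continuous_coeff_subst (p : MvPolynomial (Fin 2) ℂ) (d : Fin 2 →₀ ℕ) :
    Continuous fun x : SU2 => coeff d (subst x p) := by
  have hentry (i j : Fin 2) : Continuous fun x : SU2 => x.val i j :=
    continuous_subtype_val.matrix_elem i j
  have hX (j : Fin 2) (d : Fin 2 →₀ ℕ) : Continuous fun x : SU2 => coeff d (subst x (X j)) := by
    simp only [subst_X, coeff_add, coeff_C_mul]
    exact ((hentry 0 j).mul continuous_const).add ((hentry 1 j).mul continuous_const)
  induction p using MvPolynomial.induction_on generalizing d with
  | C a => simpa only [subst, algHom_C] using continuous_const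
  | add p q hp hq => simpa only [map_add, coeff_add] using! (hp d).add (hq d)
  | mul_X p j hp =>
    classical
    simp only [map_mul, coeff_mul]
    exact continuous_finsetSum _ fun k _ => (hp _).mul (hX j _)

@[fun_prop]
theorem continuous_irrepMatrix (n : ℕ) (i j : Fin (n + 1)) :
    Continuous fun x => irrepMatrix n x i j := by
  simp only [irrepMatrix_apply]
  exact continuous_coeff_subst _ _

@[fun_prop]
theorem continuous_character (n : ℕ) : Continuous (character n) := by
  simp only [← funext (trace_irrepMatrix n), Matrix.trace, Matrix.diag_apply]
  fun_prop

theorem isClassFunction_character (n : ℕ) : IsClassFunction (character n) := fun x y => by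
  simp only [← trace_irrepMatrix, irrepMatrix_mul, Matrix.trace_mul_comm (irrepMatrix n x)]

theorem character_torus (n : ℕ) (θ : ℝ) :
    character n (torus θ) = ((Polynomial.Chebyshev.U ℝ n).eval (Real.cos θ) : ℝ) := by
  rw [← trace_irrepMatrix, irrepMatrix_torus, Matrix.trace_diagonal,
    Polynomial.Chebyshev.complex_ofReal_eval_U,
    ← sum_pow_mul_pow_eq_eval_U (z := exp (θ * I)) (w := exp (-(θ * I)))]
  · exact (Finset.sum_range fun j => exp (θ * I) ^ j * exp (-(θ * I)) ^ (n - j)).symm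
  · rw [← exp_add, add_neg_cancel, exp_zero]
  · rw [ofReal_cos, two_cos, neg_mul]

theorem character_eq_eval_U (n : ℕ) (x : SU2) :
    character n x = ((Polynomial.Chebyshev.U ℝ n).eval (halfTrace x) : ℝ) := by
  rw [← apply_torus_eq (isClassFunction_character n) (cos_arccos_halfTrace x), character_torus,
    cos_arccos_halfTrace]

theorem exists_torus_weights_injective (n : ℕ) : ∃ θ : ℝ, Function.Injective
    fun j : Fin (n + 1) => exp (θ * I) ^ (j : ℕ) * exp (-(θ * I)) ^ (n - j : ℕ) := by
  refine ⟨Real.pi / (n + 1), fun i j hij => ?_⟩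
  have hweight (j : Fin (n + 1)) : exp (↑(Real.pi / (n + 1)) * I) ^ (j : ℕ) *
      exp (-(↑(Real.pi / (n + 1)) * I)) ^ (n - j : ℕ) =
      exp (↑((2 * j - n : ℝ) * (Real.pi / (n + 1))) * I) := by
    rw [← exp_nat_mul, ← exp_nat_mul, ← exp_add, Nat.cast_sub (Nat.lt_succ_iff.mp j.2)]
    push_cast
    ring_nf
  have hbound (j : Fin (n + 1)) : |(2 * j - n : ℝ) * (Real.pi / (n + 1))| < Real.pi := by
    have hj : (j : ℝ) ≤ n := Nat.cast_le.mpr (Nat.lt_succ_iff.mp j.2)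
    have hj₀ : (0 : ℝ) ≤ j := Nat.cast_nonneg _
    calc |(2 * j - n : ℝ) * (Real.pi / (n + 1))| = |(2 * j - n : ℝ)| * (Real.pi / (n + 1)) := by
          rw [abs_mul, abs_of_pos (div_pos Real.pi_pos n.cast_add_one_pos)]
      _ < (n + 1) * (Real.pi / (n + 1)) := by
          gcongr
          exact abs_lt.mpr ⟨by linarith [hj₀], by linarith⟩
      _ = Real.pi := mul_div_cancel₀ _ (Nat.cast_add_one_ne_zero n)
  have him (j : Fin (n + 1)) :
      -Real.pi < (((2 * j - n : ℝ) * (Real.pi / (n + 1)) : ℝ) * I).im ∧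
        (((2 * j - n : ℝ) * (Real.pi / (n + 1)) : ℝ) * I).im ≤ Real.pi := by
    rw [mul_I_im, ofReal_re]
    exact (abs_lt.mp (hbound j)).imp_right le_of_lt
  simp only [hweight] at hij
  have hlog := exp_inj_of_neg_pi_lt_of_le_pi (him i).1 (him i).2 (him j).1 (him j).2 hij
  have heq := ofReal_injective (mul_right_cancel₀ I_ne_zero hlog)
  have hval : (i : ℝ) = j := by
    linarith [mul_right_cancel₀ (div_pos Real.pi_pos n.cast_add_one_pos).ne' heq]
  exact Fin.ext (Nat.cast_injective hval)

/-- Schur's lemma for `π_n`: the torus forces `A` to be diagonal, and an element whose last column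
has no zero entry forces the diagonal to be constant. -/
theorem exists_eq_smul_one_of_commute_irrepMatrix {n : ℕ}
    {A : Matrix (Fin (n + 1)) (Fin (n + 1)) ℂ} (hA : ∀ x, Commute (irrepMatrix n x) A) :
    ∃ c : ℂ, A = c • (1 : Matrix (Fin (n + 1)) (Fin (n + 1)) ℂ) := by
  obtain ⟨θ, hθ⟩ := exists_torus_weights_injective n
  have hr : normSq ((√2)⁻¹ : ℝ) + normSq ((√2)⁻¹ : ℝ) = 1 := by
    rw [normSq_ofReal, ← mul_inv, Real.mul_self_sqrt zero_le_two]
    norm_num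
  set r := ofFirstColumn _ _ hr with hr_def
  have hcol (i : Fin (n + 1)) : irrepMatrix n r i (Fin.last n) ≠ 0 := by
    have hchoose : n.choose i ≠ 0 := (Nat.choose_pos (Nat.lt_succ_iff.mp i.2)).ne'
    simp [irrepMatrix_last, hr_def, ofFirstColumn, hchoose]
  have htorus := hA (torus θ)
  rw [irrepMatrix_torus] at htorus
  exact ⟨_, eq_smul_one_of_commute hθ htorus hcol (hA r).symm⟩

end Irrep

instance : haar.IsHaarMeasure := by
  unfold haar
  infer_instance

instance : IsProbabilityMeasure haar :=
  ⟨Measure.haarMeasure_self (K₀ := (⊤ : TopologicalSpace.PositiveCompacts SU2))⟩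

instance : SecondCountableTopology SU2 :=
  have : SecondCountableTopology (Matrix (Fin 2) (Fin 2) ℂ) :=
    inferInstanceAs (SecondCountableTopology (Fin 2 → Fin 2 → ℂ))
  TopologicalSpace.Subtype.secondCountableTopology _

instance : haar.IsMulRightInvariant where
  map_mul_right_eq_self g := by
    have : IsProbabilityMeasure (haar.map (· * g)) :=
      Measure.isProbabilityMeasure_map (continuous_mul_const g).aemeasurable
    exact Measure.isHaarMeasure_eq_of_isProbabilityMeasure _ _

instance : haar.IsInvInvariant where
  inv_eq_self := by
    have : IsProbabilityMeasure haar.inv :=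
      Measure.isProbabilityMeasure_map continuous_inv.aemeasurable
    have : haar.inv.IsHaarMeasure := {}
    exact Measure.isHaarMeasure_eq_of_isProbabilityMeasure _ _

theorem integrable_of_continuous {E : Type*} [NormedAddCommGroup E] {f : SU2 → E}
    (hf : Continuous f) : Integrable f haar :=
  hf.integrable_of_hasCompactSupport (HasCompactSupport.of_compactSpace f)

theorem continuous_conv {f g : SU2 → ℂ} (hf : Continuous f) (hg : Continuous g) :
    Continuous (conv f g) := by
  have hcont : Continuous (Function.uncurry fun x y : SU2 => f (x * y⁻¹) * g y) := by
    unfold Function.uncurry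
    fun_prop
  unfold conv
  simpa only [Measure.restrict_univ] using
    continuous_parametric_integral_of_continuous (μ := haar) hcont isCompact_univ

theorem conv_eq_integral_mul_inv_mul (f g : SU2 → ℂ) (x : SU2) :
    conv f g x = ∫ y, f y * g (y⁻¹ * x) ∂haar := by
  rw [conv, ← integral_div_left_eq_self (fun y => f y * g (y⁻¹ * x)) haar x]
  simp only [div_eq_mul_inv, mul_inv_rev, inv_inv, inv_mul_cancel_right]

/-- The left and right translates of `f` that enter `f ∗ h` and `h ∗ f` are separated by testing
against the conjugate `h` of their difference. -/
theorem isClassFunction_of_isCentral {f : SU2 → ℂ} (hf : Continuous f) (hc : IsCentral f) :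
    IsClassFunction f := fun x y => by
  set k : SU2 → ℂ := fun z => f (x * z⁻¹) - f (z⁻¹ * x) with hk
  have hkc : Continuous k := by fun_prop
  set h : SU2 → ℂ := fun z => conj (k z)
  have hhc : Continuous h := by fun_prop
  have hconv : conv f h = conv h f :=
    ((continuous_conv hf hhc).ae_eq_iff_eq haar (continuous_conv hhc hf)).mp
      (hc.2 h (integrable_of_continuous hhc))
  have hint : ∫ z, ‖k z‖ ^ 2 ∂haar = 0 := by
    have hx := congrFun hconv x
    rw [conv_eq_integral_mul_inv_mul h, conv, ← sub_eq_zero, ← integral_sub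
      (integrable_of_continuous (by fun_prop)) (integrable_of_continuous (by fun_prop))] at hx
    rw [← ofReal_eq_zero, ← integral_complex_ofReal, ← hx]
    congr 1 with z
    rw [ofReal_pow, ← mul_conj', mul_comm (h z), ← sub_mul]
  have hzero : (fun z => ‖k z‖ ^ 2) = 0 := by
    have hc2 : Continuous fun z => ‖k z‖ ^ 2 := by fun_prop
    rw [← hc2.ae_eq_iff_eq haar continuous_zero]
    exact (integral_eq_zero_iff_of_nonneg (fun z => sq_nonneg _)
      (integrable_of_continuous hc2)).mp hint
  have hy := congrFun hzero y⁻¹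
  simpa only [Pi.zero_apply, sq_eq_zero_iff, norm_eq_zero, hk, inv_inv, sub_eq_zero] using hy

/-- The matrix-valued Fourier coefficient `∫ f(y) π_n(y⁻¹) dμ(y)` of `f`. -/
noncomputable def fourierMatrix (f : SU2 → ℂ) (n : ℕ) : Matrix (Fin (n + 1)) (Fin (n + 1)) ℂ :=
  Matrix.of fun i j => ∫ y, f y * irrepMatrix n y⁻¹ i j ∂haar

section FourierMatrix

variable {f : SU2 → ℂ} (hf : Continuous f) (n : ℕ)
include hf

theorem fourierMatrix_mul_apply (g : SU2) (i j : Fin (n + 1)) :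
    (fourierMatrix f n * irrepMatrix n g) i j =
      ∫ y, f y * irrepMatrix n (y⁻¹ * g) i j ∂haar := by
  simp only [irrepMatrix_mul, Matrix.mul_apply, Finset.mul_sum, fourierMatrix, Matrix.of_apply,
    ← integral_mul_const, ← mul_assoc]
  exact (integral_finsetSum _ fun k _ => integrable_of_continuous (by fun_prop)).symm

theorem mul_fourierMatrix_apply (g : SU2) (i j : Fin (n + 1)) :
    (irrepMatrix n g * fourierMatrix f n) i j =
      ∫ y, f y * irrepMatrix n (g * y⁻¹) i j ∂haar := by
  simp only [irrepMatrix_mul, Matrix.mul_apply, Finset.mul_sum, fourierMatrix, Matrix.of_apply,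
    ← integral_const_mul, mul_left_comm (f _)]
  exact (integral_finsetSum _ fun k _ => integrable_of_continuous (by fun_prop)).symm

theorem commute_fourierMatrix (hcl : IsClassFunction f) (g : SU2) :
    Commute (irrepMatrix n g) (fourierMatrix f n) := by
  ext i j
  rw [mul_fourierMatrix_apply hf, fourierMatrix_mul_apply hf,
    ← integral_mul_left_eq_self (fun y => f y * irrepMatrix n (y⁻¹ * g) i j) g,
    ← integral_mul_right_eq_self (fun y => f y * irrepMatrix n (g * y⁻¹) i j) g]
  simp only [mul_inv_rev, mul_inv_cancel_left, inv_mul_cancel_right, hcl g]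

theorem conv_character_eq_trace (x : SU2) :
    conv f (character n) x = (fourierMatrix f n * irrepMatrix n x).trace := by
  simp only [Matrix.trace, Matrix.diag_apply, fourierMatrix_mul_apply hf]
  rw [← integral_finsetSum _ fun i _ => integrable_of_continuous (by fun_prop)]
  simp only [conv_eq_integral_mul_inv_mul, ← trace_irrepMatrix, Matrix.trace, Matrix.diag_apply,
    Finset.mul_sum]

theorem trace_fourierMatrix :
    (fourierMatrix f n).trace = ∫ y, f y * character n y ∂haar := by
  simp only [Matrix.trace, Matrix.diag_apply, fourierMatrix, Matrix.of_apply]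
  rw [← integral_finsetSum _ fun i _ => integrable_of_continuous (by fun_prop)]
  congr 1 with y
  rw [← apply_inv (isClassFunction_character n), ← trace_irrepMatrix, Matrix.trace,
    Finset.mul_sum]
  rfl

theorem conv_character (hcl : IsClassFunction f) (x : SU2) :
    (n + 1) * conv f (character n) x = (∫ y, f y * character n y ∂haar) * character n x := by
  obtain ⟨c, hc⟩ := exists_eq_smul_one_of_commute_irrepMatrix (commute_fourierMatrix hf n hcl)
  rw [conv_character_eq_trace hf, ← trace_fourierMatrix hf, hc, smul_mul_assoc, one_mul,
    Matrix.trace_smul, Matrix.trace_smul, Matrix.trace_one, trace_irrepMatrix, Fintype.card_fin]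
  push_cast
  simp only [smul_eq_mul]
  ring

end FourierMatrix

section WeylIntegration

open Polynomial.Chebyshev

theorem integral_character {n : ℕ} (hn : n ≠ 0) : ∫ y, character n y ∂haar = 0 := by
  set θ : ℝ := Real.pi / (n + 1)
  have hzero : character n (torus θ) = 0 := by
    have hn' : (1 : ℝ) < n + 1 := lt_add_of_pos_left 1 (Nat.cast_pos.mpr hn.pos)
    have hU := U_real_cos θ n
    rw [Int.cast_natCast, mul_div_cancel₀ _ (by positivity), Real.sin_pi] at hU
    have hsin : 0 < Real.sin θ :=
      Real.sin_pos_of_pos_of_lt_pi (by positivity) (div_lt_self Real.pi_pos hn')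
    rw [character_torus, (mul_eq_zero.mp hU).resolve_right hsin.ne', ofReal_zero]
  have hconv := conv_character (f := fun _ => 1) continuous_const n (fun _ _ => rfl) (torus θ)
  simp only [hzero, mul_zero, conv, one_mul] at hconv
  exact (mul_eq_zero.mp hconv).resolve_left n.cast_add_one_ne_zero

/-- The measure `π⁻¹ sin² θ dθ` on `(-π, π]`, the law of the eigenangle of a Haar distributed
element of `SU(2)` with a random sign. -/
noncomputable def weylMeasure : Measure ℝ :=
  (volume.restrict (Set.Ioc (-Real.pi) Real.pi)).withDensity
    fun θ => ENNReal.ofReal (Real.pi⁻¹ * Real.sin θ ^ 2)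

instance : IsFiniteMeasure weylMeasure :=
  isFiniteMeasure_withDensity_ofReal
    (Continuous.integrableOn_Ioc (by fun_prop)).hasFiniteIntegral

variable {E : Type*} [NormedAddCommGroup E] [NormedSpace ℝ E]

theorem integral_weylMeasure (F : ℝ → E) : ∫ θ, F θ ∂weylMeasure =
    Real.pi⁻¹ • ∫ θ in -Real.pi..Real.pi, Real.sin θ ^ 2 • F θ := by
  rw [weylMeasure, integral_withDensity_eq_integral_toReal_smul (by fun_prop) (by simp),
    ← intervalIntegral.integral_of_le (by linarith [Real.pi_pos]),
    ← intervalIntegral.integral_smul]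
  refine intervalIntegral.integral_congr fun θ _ => ?_
  simp only [ENNReal.toReal_ofReal (show 0 ≤ Real.pi⁻¹ * Real.sin θ ^ 2 by positivity), mul_smul]

theorem sin_sq_mul_eval_U_cos (n : ℕ) (θ : ℝ) : Real.sin θ ^ 2 * (U ℝ n).eval (Real.cos θ) =
    1 / 2 * (Real.cos (n * θ) - Real.cos ((n + 2 : ℕ) * θ)) := by
  have hU := U_real_cos θ n
  rw [Int.cast_natCast] at hU
  rw [show (n : ℝ) * θ = (n + 1) * θ - θ by ring,
    show ((n + 2 : ℕ) : ℝ) * θ = (n + 1) * θ + θ by push_cast; ring, Real.cos_sub, Real.cos_add]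
  linear_combination Real.sin θ * hU

theorem integral_eval_U_cos_smul {F : ℝ → E} (hF : Continuous F) (n : ℕ) :
    ∫ θ, (U ℝ n).eval (Real.cos θ) • F θ ∂weylMeasure =
      (1 / 2 : ℝ) • (cosCoeff F n - cosCoeff F (n + 2)) := by
  simp only [integral_weylMeasure, smul_smul (Real.sin _ ^ 2), sin_sq_mul_eval_U_cos, mul_smul,
    sub_smul, cosCoeff]
  rw [intervalIntegral.integral_smul, intervalIntegral.integral_sub
    (Continuous.intervalIntegrable (by fun_prop) _ _)
    (Continuous.intervalIntegrable (by fun_prop) _ _), smul_comm, smul_sub Real.pi⁻¹]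

theorem integral_eval_U_halfTrace (n : ℕ) : ∫ y, (U ℝ n).eval (halfTrace y) ∂haar =
    ∫ θ, (U ℝ n).eval (Real.cos θ) ∂weylMeasure := by
  have hweyl := integral_eval_U_cos_smul (F := fun _ => (1 : ℝ)) continuous_const n
  simp only [smul_eq_mul, mul_one, cosCoeff_one] at hweyl
  rw [hweyl]
  obtain rfl | hn := eq_or_ne n 0
  · simp
  · have hchar := integral_character hn
    simp only [character_eq_eval_U, integral_complex_ofReal, ofReal_eq_zero] at hchar
    simp [hchar, hn]

theorem map_halfTrace_haar : haar.map halfTrace = weylMeasure.map Real.cos := by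
  have hhalf : AEMeasurable halfTrace haar := continuous_halfTrace.aemeasurable
  have hcos : AEMeasurable Real.cos weylMeasure := Real.continuous_cos.aemeasurable
  refine measure_ext_of_span_eq_top (a := -1) (b := 1)
    ((ae_map_iff hhalf measurableSet_Icc).mpr (ae_of_all _ halfTrace_mem_Icc))
    ((ae_map_iff hcos measurableSet_Icc).mpr (ae_of_all _ Real.cos_mem_Icc))
    span_range_chebyshevU ?_
  rintro _ ⟨n, rfl⟩
  rw [integral_map hhalf (Polynomial.continuous _).aestronglyMeasurable,
    integral_map hcos (Polynomial.continuous _).aestronglyMeasurable, integral_eval_U_halfTrace]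

/-- Weyl's integration formula. -/
theorem integral_haar_eq_integral_torus {f : SU2 → E} (hf : Continuous f)
    (hcl : IsClassFunction f) : ∫ y, f y ∂haar = ∫ θ, f (torus θ) ∂weylMeasure := by
  set g : ℝ → E := fun t => f (torus (Real.arccos t))
  have hgc : Continuous g := hf.comp (continuous_torus.comp Real.continuous_arccos)
  have hf_eq (x : SU2) : f x = g (halfTrace x) :=
    (apply_torus_eq hcl (cos_arccos_halfTrace x)).symm
  simp only [hf_eq, halfTrace_torus]
  rw [← integral_map continuous_halfTrace.aemeasurable hgc.aestronglyMeasurable,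
    map_halfTrace_haar,
    integral_map Real.continuous_cos.aemeasurable hgc.aestronglyMeasurable]

end WeylIntegration

section Localization

open Polynomial.Chebyshev

variable {f : SU2 → ℂ}

theorem fourierSum_eq_sum_character (hf : Continuous f) (hcl : IsClassFunction f) (N : ℕ)
    (x : SU2) : fourierSum N f x =
      ∑ n ∈ Finset.range (N + 1), (∫ y, f y * character n y ∂haar) * character n x := by
  simp only [← conv_character hf _ hcl, fourierSum, conv, dirichletKernel, Finset.mul_sum,
    ← integral_const_mul]
  rw [integral_finsetSum _ fun n _ => integrable_of_continuous (by fun_prop)]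
  simp only [mul_left_comm]

theorem integral_mul_character (hf : Continuous f) (hcl : IsClassFunction f) (n : ℕ) :
    ∫ y, f y * character n y ∂haar =
      (1 / 2 : ℝ) • (cosCoeff (f ∘ torus) n - cosCoeff (f ∘ torus) (n + 2)) := by
  rw [← integral_eval_U_cos_smul (hf.comp continuous_torus), integral_haar_eq_integral_torus
    (by fun_prop) fun x y => by rw [hcl, isClassFunction_character]]
  simp only [character_torus, mul_comm (f _), real_smul, Function.comp_apply]

/-- The terms `U_{N-1}(cos θ) a_{N+1}`, where `x` has eigenvalues `exp(± i θ)` and `a` is the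
sequence of cosine coefficients of `f`, whose averages are what distinguishes `S_N f` from the
cosine series of `f`. -/
noncomputable def edgeTerm (f : SU2 → ℂ) (N : ℕ) (x : SU2) : ℂ :=
  (U ℝ (N - 1)).eval (halfTrace x) • cosCoeff (f ∘ torus) (N + 1)

theorem norm_edgeTerm (N : ℕ) (x : SU2) : ‖edgeTerm f N x‖ =
    |(U ℝ (N - 1)).eval (halfTrace x)| * ‖cosCoeff (f ∘ torus) (N + 1)‖ :=
  norm_smul _ _

theorem edgeTerm_one (N : ℕ) : edgeTerm f N 1 = (N : ℝ) • cosCoeff (f ∘ torus) (N + 1) := by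
  rw [edgeTerm, ← torus_zero, halfTrace_torus, Real.cos_zero, U_eval_one]
  push_cast
  rw [sub_add_cancel]

theorem edgeTerm_negOne (N : ℕ) : edgeTerm f N negOne =
    -((N : ℝ) • (-1 : ℝ) ^ N • cosCoeff (f ∘ torus) (N + 1)) := by
  have hsign : (((N - 1 : ℤ).negOnePow : ℤ) : ℝ) = -(-1) ^ N := by simp [Int.negOnePow_sub]
  rw [edgeTerm, ← torus_pi, halfTrace_torus, Real.cos_pi, U_eval_neg_one, hsign]
  push_cast
  rw [sub_add_cancel]
  module

theorem fourierSum_eq_cosPartialSum_sub (hf : Continuous f) (hcl : IsClassFunction f) (N : ℕ)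
    {x : SU2} {θ : ℝ} (hθ : Real.cos θ = halfTrace x) : fourierSum N f x =
      cosPartialSum (f ∘ torus) N θ - (1 / 2 : ℝ) • (edgeTerm f N x + edgeTerm f (N + 1) x) := by
  have hsum := sum_eval_U_smul_sub (cosCoeff (f ∘ torus)) N (halfTrace x)
  simp only [← hθ, T_real_cos, Int.cast_natCast] at hsum
  rw [cosPartialSum, edgeTerm, edgeTerm, ← hθ, Nat.cast_succ, add_sub_cancel_right, ← hsum,
    fourierSum_eq_sum_character hf hcl]
  refine Finset.sum_congr rfl fun n _ => ?_
  rw [integral_mul_character hf hcl, character_eq_eval_U, ← hθ, mul_comm, ← real_smul]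

variable {α M : ℝ} (hα : 0 < α) (hf : ∀ x y, ‖f x - f y‖ ≤ M * distance x y ^ α)
  (hcl : IsClassFunction f)
include hα hf hcl

theorem tendstoUniformlyOn_fourierSum_of_edgeTerm {A : Set SU2}
    (hA : TendstoUniformlyOn (edgeTerm f) 0 atTop A) :
    TendstoUniformlyOn (fun N => fourierSum N f) f atTop A := by
  have hcos := (tendstoUniformly_cosPartialSum (Real.toNNReal_pos.mpr hα)
    (holderWith_comp_torus hα.le hf) (periodic_comp_torus hcl) (even_comp_torus hcl)).comp
    fun x => Real.arccos (halfTrace x)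
  have hcos' := hcos.tendstoUniformlyOn.congr_right (s := A) fun x _ =>
    apply_torus_eq hcl (cos_arccos_halfTrace x)
  have hA_succ : TendstoUniformlyOn (fun N => edgeTerm f (N + 1)) 0 atTop A := fun u hu =>
    (tendsto_add_atTop_nat 1).eventually (hA u hu)
  have hhalf := (uniformContinuous_const_smul (1 / 2 : ℝ)).comp_tendstoUniformlyOn (hA.add hA_succ)
  refine ((hcos'.sub hhalf).congr_right fun x _ => ?_).congr (.of_forall fun N x _ => ?_)
  · simp only [Pi.sub_apply, Function.comp_apply, Pi.zero_apply, add_zero, smul_zero, sub_zero]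
  · exact (fourierSum_eq_cosPartialSum_sub (continuous_of_norm_sub_le_distance_rpow hα hf) hcl N
      (cos_arccos_halfTrace x)).symm

theorem tendsto_edgeTerm_add_succ {x : SU2} {l : ℂ}
    (hl : Tendsto (fun N => fourierSum N f x) atTop (𝓝 l)) :
    Tendsto (fun N => edgeTerm f N x + edgeTerm f (N + 1) x) atTop
      (𝓝 ((2 : ℝ) • (f x - l))) := by
  have hcos := tendsto_cosPartialSum (Real.toNNReal_pos.mpr hα) (holderWith_comp_torus hα.le hf)
    (periodic_comp_torus hcl) (even_comp_torus hcl) (Real.arccos (halfTrace x))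
  rw [Function.comp_apply, apply_torus_eq hcl (cos_arccos_halfTrace x)] at hcos
  refine ((hcos.sub hl).const_smul (2 : ℝ)).congr fun N => ?_
  rw [fourierSum_eq_cosPartialSum_sub (continuous_of_norm_sub_le_distance_rpow hα hf) hcl N
    (cos_arccos_halfTrace x), sub_sub_cancel, smul_smul]
  norm_num

theorem tendstoUniformlyOn_edgeTerm_of_isCompact {K : Set SU2} (hK : IsCompact K) (h1 : 1 ∉ K)
    (h_neg : negOne ∉ K) : TendstoUniformlyOn (edgeTerm f) 0 atTop K := by
  have hcoeff := tendsto_zero_of_tendsto_sum_range <|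
    tendsto_sum_cosCoeff (Real.toNNReal_pos.mpr hα) (holderWith_comp_torus hα.le hf)
      (periodic_comp_torus hcl) (even_comp_torus hcl)
  have hpos (x : SU2) (hx : x ∈ K) : 0 < √(1 - halfTrace x ^ 2) := by
    have hle := (sq_le_one_iff_abs_le_one _).mpr (abs_le.mpr (halfTrace_mem_Icc x))
    refine Real.sqrt_pos.mpr (sub_pos.mpr (hle.lt_of_ne fun h => ?_))
    obtain rfl | rfl := eq_one_or_eq_negOne_of_halfTrace_sq_eq_one h
    · exact h1 hx
    · exact h_neg hx
  obtain ⟨c, hc, hcK⟩ := hK.exists_forall_le' (f := fun x => √(1 - halfTrace x ^ 2))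
    (by fun_prop) hpos
  have hbound (N : ℕ) (x : SU2) (hx : x ∈ K) :
      ‖edgeTerm f N x‖ ≤ c⁻¹ * ‖cosCoeff (f ∘ torus) (N + 1)‖ := by
    rw [norm_edgeTerm]
    gcongr
    rw [← one_div, le_div_iff₀ hc]
    calc _ ≤ |(U ℝ (N - 1)).eval (halfTrace x)| * √(1 - halfTrace x ^ 2) := by
          gcongr
          exact hcK x hx
      _ ≤ 1 := abs_eval_U_mul_sqrt_le_one _ (halfTrace_mem_Icc x)
  exact tendstoUniformlyOn_zero_of_norm_le hbound (by simpa using hcoeff.norm.const_mul c⁻¹)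

theorem tendstoUniformly_edgeTerm {l l' : ℂ}
    (hl : Tendsto (fun N => fourierSum N f 1) atTop (𝓝 l))
    (hl' : Tendsto (fun N => fourierSum N f negOne) atTop (𝓝 l')) :
    TendstoUniformly (edgeTerm f) 0 atTop := by
  have hr := Real.toNNReal_pos.mpr hα
  have hF := holderWith_comp_torus hα.le hf
  have hsum := tendsto_sum_cosCoeff hr hF (periodic_comp_torus hcl) (even_comp_torus hcl)
  have hsum' := tendsto_sum_neg_one_pow_smul_cosCoeff hr hF (periodic_comp_torus hcl)
    (even_comp_torus hcl)
  have hedge := tendsto_edgeTerm_add_succ hα hf hcl hl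
  have hedge' := (tendsto_edgeTerm_add_succ hα hf hcl hl').neg
  simp only [edgeTerm_one, edgeTerm_negOne, Nat.cast_succ, neg_add, neg_neg] at hedge hedge'
  have hcoeff := tendsto_natCast_smul_of_tendsto_add_succ hsum hsum' hedge hedge'
  rw [← tendstoUniformlyOn_univ]
  refine tendstoUniformlyOn_zero_of_norm_le (fun N x _ => ?_)
    (by simpa only [norm_zero] using hcoeff.norm)
  rw [norm_edgeTerm, norm_smul, Real.norm_natCast]
  gcongr
  exact abs_eval_U_natCast_sub_one_le N (halfTrace_mem_Icc x)

end Localization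

end SU2

theorem mainTheorem2_general {α M : ℝ} (hα : 0 < α) {f : SU2 → ℂ}
    (hf : ∀ x y, ‖f x - f y‖ ≤ M * SU2.distance x y ^ α) (hc : SU2.IsCentral f) :
    (∀ U : Set SU2, IsOpen U → 1 ∈ U → SU2.negOne ∈ U →
      TendstoUniformlyOn (fun N => SU2.fourierSum N f) f atTop Uᶜ) ∧
    ((∃ l, Tendsto (fun N => SU2.fourierSum N f 1) atTop (𝓝 l)) →
      (∃ l, Tendsto (fun N => SU2.fourierSum N f SU2.negOne) atTop (𝓝 l)) →
      TendstoUniformly (fun N => SU2.fourierSum N f) f atTop) := by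
  have hcl := SU2.isClassFunction_of_isCentral
    (SU2.continuous_of_norm_sub_le_distance_rpow hα hf) hc
  constructor
  · intro U hU h1 h_neg
    exact SU2.tendstoUniformlyOn_fourierSum_of_edgeTerm hα hf hcl
      (SU2.tendstoUniformlyOn_edgeTerm_of_isCompact hα hf hcl hU.isClosed_compl.isCompact
        (not_not_intro h1) (not_not_intro h_neg))
  · rintro ⟨l, hl⟩ ⟨l', hl'⟩
    exact tendstoUniformlyOn_univ.mp (SU2.tendstoUniformlyOn_fourierSum_of_edgeTerm hα hf hcl
      (SU2.tendstoUniformly_edgeTerm hα hf hcl hl hl').tendstoUniformlyOn)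

theorem mainTheorem2 (α : ℝ) (hα0 : 0 < α) (hα1 : α < 1) (f : SU2 → ℝ)
    (hf : SU2.IsHolder α f) (hc : SU2.IsCentral fun x => (f x : ℂ)) :
    (∀ U : Set SU2, IsOpen U → 1 ∈ U → SU2.negOne ∈ U →
      TendstoUniformlyOn (fun (N : ℕ) (x : SU2) => SU2.fourierSum N (fun y => (f y : ℂ)) x)
        (fun x => (f x : ℂ)) atTop Uᶜ) ∧
    ((∃ l : ℂ, Tendsto (fun N : ℕ => SU2.fourierSum N (fun y => (f y : ℂ)) 1) atTop (𝓝 l)) →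
      (∃ l : ℂ, Tendsto (fun N : ℕ => SU2.fourierSum N (fun y => (f y : ℂ)) SU2.negOne)
        atTop (𝓝 l)) →
      TendstoUniformly (fun (N : ℕ) (x : SU2) => SU2.fourierSum N (fun y => (f y : ℂ)) x)
        (fun x => (f x : ℂ)) atTop) := by
  obtain ⟨M, -, hM⟩ := hf
  exact mainTheorem2_general hα0 (fun x y => by simpa [← Complex.ofReal_sub] using hM x y) hc
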